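/- Let $M$ be a non-empty closed (compact, without boundary, Hausdorff) smooth manifold of dimension $2n+1$, and let $\xi=\ker\alpha$ be a co-oriented contact structure on $M$ with contact form $\alpha$, i.e. $\alpha$ is a smooth $1$-form such that $\alpha\wedge(d\alpha)^n$ vanishes nowhere. A contactomorphism is a diffeomorphism of $M$ preserving $\xi$, and $\mathrm{Cont}_0(M)$ is the group of contactomorphisms that are smoothly isotopic to $\mathrm{id}_M$ through contactomorphisms. For a smooth isotopy $(\phi_t)_{t\in[0,1]}$ of contactomorphisms let $X_t^{\phi}$ be the vector field defined by $X_t^{\phi}\circ\phi_t=\frac{d}{ds}\big|_{s=t}\phi_s$. For $\phi,\psi\in\mathrm{Cont}_0(M)$ write $\phi\preccurlyeq\psi$ if there is such an isotopy with $\phi_0=\phi$, $\phi_1=\psi$ and $\alpha(X_t^{\phi})\ge 0$ for all $t$, and call $\mathrm{Cont}_0(M)$ orderable if $\preccurlyeq$ is a partial order on $\mathrm{Cont}_0(M)$. The Shelukhin norm of $\phi\in\mathrm{Cont}_0(M)$ is $$|\phi|_{\alpha}=\inf\left\{\int_0^1\max_M|\alpha(X_t^{\phi})|\,dt\ \middle|\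 (\phi_t)_{t\in[0,1]}\text{ a smooth isotopy of contactomorphisms with }\phi_0=\mathrm{id}_M,\ \phi_1=\phi\right\}.$$ The Reeb vector field $R$ of $\alpha$ is given by $\alpha(R)=1$, $d\alpha(R,\cdot)=0$, and the Reeb flow $\phi_t^{\alpha}$ is its flow. Suppose that $\mathrm{Cont}_0(M)$ is orderable. Then the Reeb flow $(\phi_t^{\alpha})_{t\in\mathbb R}$ exists for all times and is unique, and for every $t\in\mathbb{R}$ one has $\phi_t^{\alpha}\in\mathrm{Cont}_0(M)$ and $$|\phi_t^{\alpha}|_{\alpha}=|t|.$$ In particular $$\sup_{\phi\in\mathrm{Cont}_0(M)}|\phi|_{\alpha}=\infty.$$ -/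

import Mathlib

open scoped Manifold ContDiff Topology

namespace ContactGeom

noncomputable section

variable {E : Type*} [NormedAddCommGroup E] [NormedSpace ℝ E]
  {M : Type*} [TopologicalSpace M] [ChartedSpace E M]

/-! ### One-forms and contact forms -/

/-- A (not necessarily smooth) one-form on `M`: a covector on every tangent space. -/
abbrev OneForm (E : Type*) [NormedAddCommGroup E] [NormedSpace ℝ E]
    (M : Type*) [TopologicalSpace M] [ChartedSpace E M] : Type _ :=
  ∀ x : M, TangentSpace 𝓘(ℝ, E) x →L[ℝ] ℝ

/-- A (not necessarily smooth) field of subspaces of the tangent spaces of `M`. -/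
abbrev Distribution (E : Type*) [NormedAddCommGroup E] [NormedSpace ℝ E]
    (M : Type*) [TopologicalSpace M] [ChartedSpace E M] : Type _ :=
  ∀ x : M, Submodule ℝ (TangentSpace 𝓘(ℝ, E) x)

/-- Smoothness of a one-form, as a section of the cotangent bundle. -/
def OneForm.IsSmooth [IsManifold 𝓘(ℝ, E) ∞ M] (α : OneForm E M) : Prop :=
  ContMDiff 𝓘(ℝ, E) (𝓘(ℝ, E).prod 𝓘(ℝ, E →L[ℝ] ℝ)) ∞
    (fun x ↦ Bundle.TotalSpace.mk' (E →L[ℝ] ℝ)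
      (E := fun x : M ↦ TangentSpace 𝓘(ℝ, E) x →L[ℝ] ℝ) x (α x))

/-- The expression of the one-form `α` in the preferred chart at `x₀`: the pullback of `α` under
the inverse of that chart, as a one-form on (the target of the chart in) `E`. -/
def OneForm.inChart (α : OneForm E M) (x₀ : M) (y : E) : E →L[ℝ] ℝ :=
  (α ((extChartAt 𝓘(ℝ, E) x₀).symm y)).comp
    (mfderiv 𝓘(ℝ, E) 𝓘(ℝ, E) (extChartAt 𝓘(ℝ, E) x₀).symm y)

/-- The exterior derivative `dα` at the point `x`, evaluated on tangent vectors `v, w`: the pullback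
under the chart at `x` of the exterior derivative of the expression of `α` in that chart. -/
def OneForm.d (α : OneForm E M) (x : M) (v w : TangentSpace 𝓘(ℝ, E) x) : ℝ :=
  extDeriv (fun y ↦ ContinuousAlternatingMap.ofSubsingleton ℝ E ℝ (0 : Fin 1) (α.inChart x y))
    (extChartAt 𝓘(ℝ, E) x x)
    ![(mfderiv 𝓘(ℝ, E) 𝓘(ℝ, E) (extChartAt 𝓘(ℝ, E) x) x v : E),
      (mfderiv 𝓘(ℝ, E) 𝓘(ℝ, E) (extChartAt 𝓘(ℝ, E) x) x w : E)]

/-- The `(2n+1)`-form `α ∧ (dα)^n` at `x`, up to a positive constant that depends only on `n` and on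
the normalization of the wedge product. -/
def OneForm.wedgePow (n : ℕ) (α : OneForm E M) (x : M)
    (v : Fin (2 * n + 1) → TangentSpace 𝓘(ℝ, E) x) : ℝ :=
  ∑ σ : Equiv.Perm (Fin (2 * n + 1)), ((Equiv.Perm.sign σ : ℤ) : ℝ) *
    (α x (v (σ ⟨0, by omega⟩)) *
      ∏ i : Fin n, α.d x (v (σ ⟨2 * i + 1, by omega⟩)) (v (σ ⟨2 * i + 2, by omega⟩)))

/-- `α` is a contact form for `ξ` (on a manifold of dimension `2n+1`): a smooth one-form with
`ξ = ker α` such that `α ∧ (dα)^n` is nowhere vanishing. -/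
structure IsContactForm [IsManifold 𝓘(ℝ, E) ∞ M] (n : ℕ) (ξ : Distribution E M) (α : OneForm E M) :
    Prop where
  smooth : α.IsSmooth
  ker_eq : ∀ x, LinearMap.ker (α x : TangentSpace 𝓘(ℝ, E) x →ₗ[ℝ] ℝ) = ξ x
  nondegenerate : ∀ x, ∃ v, α.wedgePow n x v ≠ 0

/-! ### The Reeb flow -/

/-- `R` is the Reeb vector field of `α`: `α(R) = 1` and `dα(R, ·) = 0`. -/
def IsReebField (α : OneForm E M) (R : ∀ x : M, TangentSpace 𝓘(ℝ, E) x) : Prop :=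
  ∀ x, α x (R x) = 1 ∧ ∀ w, α.d x (R x) w = 0

/-- `F t x` is the (global) flow of the Reeb vector field of `α`. -/
def IsReebFlow (α : OneForm E M) (F : ℝ → M → M) : Prop :=
  ∃ R : ∀ x : M, TangentSpace 𝓘(ℝ, E) x, IsReebField α R ∧
    ∀ x, F 0 x = x ∧ IsMIntegralCurve (I := 𝓘(ℝ, E)) (fun t ↦ F t x) R

/-! ### Contactomorphisms and contact isotopies -/

/-- Smooth diffeomorphisms of `M`. -/
abbrev Diffeo (E : Type*) [NormedAddCommGroup E] [NormedSpace ℝ E]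
    (M : Type*) [TopologicalSpace M] [ChartedSpace E M] : Type _ :=
  Diffeomorph 𝓘(ℝ, E) 𝓘(ℝ, E) M M ∞

/-- `φ` preserves the distribution `ξ`: `dφ(ξ_x) = ξ_{φ(x)}` for all `x`. -/
def IsContactomorphism (ξ : Distribution E M) (φ : Diffeo E M) : Prop :=
  ∀ x, (ξ x).map (mfderiv 𝓘(ℝ, E) 𝓘(ℝ, E) φ x :
    TangentSpace 𝓘(ℝ, E) x →ₗ[ℝ] TangentSpace 𝓘(ℝ, E) (φ x)) = ξ (φ x)

/-- `Φ t`, `t ∈ [0,1]`, is a smooth isotopy through contactomorphisms from `φ` to `ψ`. (The values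
of `Φ` outside `[0,1]` are irrelevant.) -/
structure IsContactIsotopy (ξ : Distribution E M) (φ ψ : Diffeo E M) (Φ : ℝ → Diffeo E M) :
    Prop where
  smooth : ContMDiffOn (𝓘(ℝ, ℝ).prod 𝓘(ℝ, E)) 𝓘(ℝ, E) ∞ (fun p : ℝ × M ↦ Φ p.1 p.2)
    (Set.Icc (0 : ℝ) 1 ×ˢ (Set.univ : Set M))
  contact : ∀ t ∈ Set.Icc (0 : ℝ) 1, IsContactomorphism ξ (Φ t)
  start : Φ 0 = φ
  finish : Φ 1 = ψ

/-- The velocity `d/ds|_{s=t} Φ s x` of an isotopy (one-sided at `t = 0, 1`). -/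
def velocity (Φ : ℝ → Diffeo E M) (t : ℝ) (x : M) : TangentSpace 𝓘(ℝ, E) (Φ t x) :=
  mfderivWithin 𝓘(ℝ, ℝ) 𝓘(ℝ, E) (fun s ↦ Φ s x) (Set.Icc (0 : ℝ) 1) t (1 : ℝ)

/-- The function `α(X_t)` on `M`, where the vector field `X_t` generating the isotopy is defined by
`X_t (Φ t x) = d/ds|_{s=t} Φ s x`. -/
def hamiltonian (α : OneForm E M) (Φ : ℝ → Diffeo E M) (t : ℝ) (y : M) : ℝ :=
  α (Φ t ((Φ t).symm y)) (velocity Φ t ((Φ t).symm y))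

/-- `Cont₀(M, ξ)`: the diffeomorphisms that are isotopic to the identity through
contactomorphisms. -/
def Cont0 (ξ : Distribution E M) : Set (Diffeo E M) :=
  {φ | ∃ Φ, IsContactIsotopy ξ (Diffeomorph.refl 𝓘(ℝ, E) M ∞) φ Φ}

/-- The relation `φ ≼ ψ` on `Cont₀(M, ξ)`: there is a non-negative contact isotopy from `φ`
to `ψ`. -/
def NonnegRel (ξ : Distribution E M) (α : OneForm E M) (φ ψ : Cont0 ξ) : Prop :=
  ∃ Φ, IsContactIsotopy ξ (φ : Diffeo E M) (ψ : Diffeo E M) Φ ∧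
    ∀ t ∈ Set.Icc (0 : ℝ) 1, ∀ y, 0 ≤ hamiltonian α Φ t y

/-- `Cont₀(M, ξ)` is orderable (for the co-orientation of `ξ` given by `α`): the relation `≼` is
a partial order. -/
def IsOrderable (ξ : Distribution E M) (α : OneForm E M) : Prop :=
  IsPartialOrder (Cont0 ξ) (NonnegRel ξ α)

/-- The Shelukhin (Hofer-type) norm `|φ|_α`: the infimum of `∫₀¹ max_M |α(X_t)| dt` over all contact
isotopies from the identity to `φ`. -/
def shelukhinNorm (ξ : Distribution E M) (α : OneForm E M) (φ : Cont0 ξ) : ℝ :=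
  sInf {L : ℝ | ∃ Φ, IsContactIsotopy ξ (Diffeomorph.refl 𝓘(ℝ, E) M ∞) (φ : Diffeo E M) Φ ∧
    L = ∫ t in (0 : ℝ)..1, ⨆ y : M, |hamiltonian α Φ t y|}

end

end ContactGeom

-- The upper bound comes from the Reeb flow itself: run over `[0,1]` at speed `t`, it has constant
-- Hamiltonian `t`, hence length `|t|`.
--
-- For the lower bound, suppose a contact isotopy `Ψ` from `φ_a` to `φ_b` had length `L < a - b`.
-- For each `s` in `(b + L, a)` there is a smooth `f` with `f 0 = 0`, `f 1 = s - b` and `f'` at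
-- least the pointwise maximum of the speed of `Ψ` (`exists_contDiff_le_deriv`). Since the Reeb flow
-- preserves `α`, the speed of `φ_{f(t)} ∘ Ψ_t` is `f'(t)` plus that of `Ψ`, hence non-negative, so
-- `φ_a ≼ φ_s`. But `s < a` gives `φ_s ≼ φ_a`, and antisymmetry forces `φ_s = φ_a` for all `s` in an
-- open interval. Reeb orbits would then have zero velocity there, against `α(R) = 1`. Hence `a - b
-- ≤ L` (`IsSmoothReebFlow.sub_le_integral`); applied to an isotopy from the identity to `φ_t` and
-- to its reversal, this bounds the length below by `|t|`.
--
-- The rest is the differential geometry behind this argument: existence, uniqueness and smoothness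
-- of the Reeb field (linear algebra of `a ∧ dⁿ`, then inversion of `reebOp`), completeness and
-- joint smoothness of its flow (implicit function theorem on a space of curves, then compactness),
-- and invariance of `α` under the flow (`reebFlow_pullback`).

universe v

namespace ContactGeom

/-! ### Smoothness of post-composition on spaces of continuous maps. -/

section Nemytskii

variable {K : Type*} [TopologicalSpace K] [CompactSpace K]
  {E : Type*} [NormedAddCommGroup E] [NormedSpace ℝ E]
  {F : Type*} [NormedAddCommGroup F] [NormedSpace ℝ F]

/-- Pointwise application of a continuous family of operators to a continuous family of vectors. -/
noncomputable def pointwiseApplyL (K : Type*) [TopologicalSpace K] [CompactSpace K]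
    (E : Type*) [NormedAddCommGroup E] [NormedSpace ℝ E]
    (F : Type*) [NormedAddCommGroup F] [NormedSpace ℝ F] :
    C(K, E →L[ℝ] F) →L[ℝ] C(K, E) →L[ℝ] C(K, F) :=
  LinearMap.mkContinuous₂
    (LinearMap.mk₂ ℝ (fun (A : C(K, E →L[ℝ] F)) (h : C(K, E)) ↦ (⟨fun k ↦ A k (h k), by fun_prop⟩ : C(K, F)))
      (fun _ _ _ ↦ by ext; simp) (fun _ _ _ ↦ by ext; simp)
      (fun _ _ _ ↦ by ext; simp) (fun _ _ _ ↦ by ext; simp)) 1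
    (fun (A : C(K, E →L[ℝ] F)) (h : C(K, E)) ↦ by
      rw [one_mul, ContinuousMap.norm_le _ (by positivity)]
      intro k
      have hA : 0 ≤ ‖A‖ := (norm_nonneg (A k)).trans (A.norm_coe_le_norm k)
      exact ((A k).le_opNorm (h k)).trans (mul_le_mul (A.norm_coe_le_norm k) (h.norm_coe_le_norm k)
        (norm_nonneg _) hA))

@[simp]
theorem pointwiseApplyL_apply (A : C(K, E →L[ℝ] F)) (h : C(K, E)) (k : K) :
    pointwiseApplyL K E F A h k = A k (h k) := rfl

/-- The mean value inequality applies on the ball of radius `‖h‖` around each `c k`. The estimate is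
uniform in `k` because `c ↦ f' ∘ c` is continuous in the sup norm: a point `x` near `c k` is a value
of the translate of `c` by the constant `x - c k`. -/
theorem hasFDerivAt_postcomp (f : C(E, F)) (f' : C(E, E →L[ℝ] F))
    (hf : ∀ x, HasFDerivAt f (f' x) x) (c : C(K, E)) :
    HasFDerivAt (fun c : C(K, E) ↦ f.comp c) (pointwiseApplyL K E F (f'.comp c)) c := by
  rw [hasFDerivAt_iff_isLittleO_nhds_zero, Asymptotics.isLittleO_iff]
  intro ε hε
  have hcont : Continuous fun c : C(K, E) ↦ f'.comp c := f'.continuous_postcomp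
  obtain ⟨δ, hδ, H⟩ := (Metric.continuous_iff (α := C(K, E)) (β := C(K, E →L[ℝ] F))).1 hcont c ε hε
  filter_upwards [Metric.ball_mem_nhds (0 : C(K, E)) hδ] with h hh
  rw [mem_ball_zero_iff] at hh
  rw [ContinuousMap.norm_le _ (by positivity)]
  intro k
  have hclose : ∀ x ∈ Metric.closedBall (c k) ‖h‖, ‖f' x - f' (c k)‖ ≤ ε := by
    intro x hx
    have h1 : dist (c + ContinuousMap.const K (x - c k)) c < δ := by
      rw [dist_eq_norm, add_sub_cancel_left]
      refine lt_of_le_of_lt ?_ hh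
      rw [ContinuousMap.norm_le _ (by positivity)]
      intro _
      simpa [← dist_eq_norm] using hx
    have h2 := (ContinuousMap.dist_apply_le_dist k).trans (H _ h1).le
    simpa [dist_eq_norm] using h2
  have := (convex_closedBall (c k) ‖h‖).norm_image_sub_le_of_norm_hasFDerivWithin_le'
    (fun x _ ↦ (hf x).hasFDerivWithinAt) hclose
    (Metric.mem_closedBall_self (norm_nonneg _))
    (show c k + h k ∈ Metric.closedBall (c k) ‖h‖ by
      simpa [dist_eq_norm] using h.norm_coe_le_norm k)
  refine le_trans (le_of_eq ?_) (this.trans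
    (mul_le_mul_of_nonneg_left (b := ‖c k + h k - c k‖) (c := ‖h‖) ?_ hε.le))
  · simp
  · simpa using h.norm_coe_le_norm k

/-- Induction works because the derivative is post-composition with `f'` followed by a bounded
linear map. The target must vary with the induction, since `f'` takes values in `E →L[ℝ] F`; hence
the common universe. -/
theorem contDiff_postcomp_nat {E : Type v} [NormedAddCommGroup E] [NormedSpace ℝ E] (n : ℕ) :
    ∀ {F : Type v} [NormedAddCommGroup F] [NormedSpace ℝ F] (f : C(E, F)), ContDiff ℝ n f →
    ContDiff ℝ n (fun c : C(K, E) ↦ f.comp c) := by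
  induction n with
  | zero =>
    intro F _ _ f hf
    exact contDiff_zero.2 f.continuous_postcomp
  | succ n ih =>
    intro F _ _ f hf
    have hf' : ContDiff ℝ n (fderiv ℝ f) := hf.fderiv_right le_rfl
    let f' : C(E, E →L[ℝ] F) := ⟨fderiv ℝ f, hf'.continuous⟩
    have hd : ∀ x, HasFDerivAt f (f' x) x := fun x ↦
      (hf.differentiable (by norm_cast) x).hasFDerivAt
    have key := hasFDerivAt_postcomp (K := K) f f' hd
    rw [Nat.cast_succ, contDiff_succ_iff_fderiv]
    refine ⟨fun c ↦ (key c).differentiableAt, by simp, ?_⟩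
    have : fderiv ℝ (fun c : C(K, E) ↦ f.comp c) =
        fun c ↦ pointwiseApplyL K E F (f'.comp c) := funext fun c ↦ (key c).fderiv
    rw [this]
    exact (pointwiseApplyL K E F).contDiff.comp (ih f' hf')

end Nemytskii

/-! ### Smooth dependence of integral curves on initial data in a Banach space. -/

section LocalFlow

theorem contDiff_postcomp {E : Type*} [NormedAddCommGroup E] [NormedSpace ℝ E] {K : Type*} [TopologicalSpace K] [CompactSpace K] (f : C(E, E))
    (hf : ContDiff ℝ ∞ f) : ContDiff ℝ ∞ (fun c : C(K, E) ↦ f.comp c) :=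
  contDiff_infty.2 fun n ↦ contDiff_postcomp_nat n f (contDiff_infty.1 hf n)

/-- The interval on which the curves of a local flow are parametrized. -/
abbrev FlowInterval : Type := Set.Icc (-1 : ℝ) 1

variable {E : Type*} [NormedAddCommGroup E]

/-- The extension of a curve to the real line, constant outside the interval. -/
noncomputable def extendCurve (c : C(FlowInterval, E)) (s : ℝ) : E :=
  c (Set.projIcc (-1 : ℝ) 1 (by norm_num) s)

theorem continuous_extendCurve (c : C(FlowInterval, E)) : Continuous (extendCurve c) :=
  c.continuous.comp continuous_projIcc

theorem norm_extendCurve_le (c : C(FlowInterval, E)) (s : ℝ) : ‖extendCurve c s‖ ≤ ‖c‖ :=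
  c.norm_coe_le_norm _

variable [NormedSpace ℝ E]

/-- The primitive vanishing at `0`, as an operator on curves. -/
noncomputable def primitiveL (E : Type*) [NormedAddCommGroup E] [NormedSpace ℝ E] :
    C(FlowInterval, E) →L[ℝ] C(FlowInterval, E) :=
  LinearMap.mkContinuous
    { toFun := fun c ↦ ⟨fun t ↦ ∫ u in (0 : ℝ)..t, extendCurve c u,
        (intervalIntegral.continuous_primitive
          (fun _ _ ↦ (continuous_extendCurve c).intervalIntegrable _ _) 0).comp
          continuous_subtype_val⟩
      map_add' := fun c d ↦ by
        ext t
        exact intervalIntegral.integral_add ((continuous_extendCurve c).intervalIntegrable _ _)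
          ((continuous_extendCurve d).intervalIntegrable _ _)
      map_smul' := fun a c ↦ by
        ext t
        exact intervalIntegral.integral_smul a _ } 1
    (fun c ↦ by
      rw [one_mul, ContinuousMap.norm_le _ (norm_nonneg _)]
      intro t
      refine (intervalIntegral.norm_integral_le_of_norm_le_const
        (fun u _ ↦ norm_extendCurve_le c u)).trans ?_
      have : |(t : ℝ) - 0| ≤ 1 := by
        rw [sub_zero, abs_le]; exact t.2
      exact mul_le_of_le_one_right (norm_nonneg _) this)

/-- A smooth vector field on a Banach space has, near `x₀`, integral curves depending smoothly on
the initial value and on the time scale. -/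
theorem exists_smooth_family_integralCurves [CompleteSpace E] (f : E → E) (hf : ContDiff ℝ ∞ f)
    (x₀ : E) (U : Set E) (hU : U ∈ 𝓝 x₀) :
    ∃ c : ℝ × E → ℝ → E, (∀ s, ContDiffAt ℝ ∞ (fun p ↦ c p s) (0, x₀)) ∧
      ∀ᶠ p in 𝓝 ((0 : ℝ), x₀), c p 0 = p.2 ∧ ∀ s ∈ Set.Ioo (-1 : ℝ) 1,
        c p s ∈ U ∧ HasDerivAt (c p) (p.1 • f (c p s)) s := by
  let fc : C(E, E) := ⟨f, hf.continuous⟩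
  let N : C(FlowInterval, E) → C(FlowInterval, E) := fun c ↦ fc.comp c
  have hN : ContDiff ℝ ∞ N := contDiff_postcomp fc hf
  let cst : E →L[ℝ] C(FlowInterval, E) := ContinuousLinearMap.const ℝ FlowInterval
  have hcst : ∀ x t, cst x t = x := fun _ _ ↦ rfl
  -- Zeros of `Ψ` are the solutions of `c' = t • f(c)`, `c(0) = x`, in integral form. Scaling time
  -- by `t` keeps the curves on a fixed interval. At `t = 0` the map is `c ↦ c - x₀`, whose
  -- derivative is the identity, so the implicit function theorem applies with no contraction
  -- estimate.
  let Ψ : (ℝ × E) × C(FlowInterval, E) → C(FlowInterval, E) :=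
    fun q ↦ q.2 - cst q.1.2 - q.1.1 • primitiveL E (N q.2)
  have hΨ : ContDiff ℝ ∞ Ψ := by
    have h1 : ContDiff ℝ ∞ fun q : (ℝ × E) × C(FlowInterval, E) ↦ primitiveL E (N q.2) :=
      (primitiveL E).contDiff.comp (hN.comp contDiff_snd)
    have h2 : ContDiff ℝ ∞ fun q : (ℝ × E) × C(FlowInterval, E) ↦ cst q.1.2 :=
      cst.contDiff.comp (contDiff_snd.comp contDiff_fst)
    exact (contDiff_snd.sub h2).sub ((contDiff_fst.comp contDiff_fst).smul h1)
  let u : (ℝ × E) × C(FlowInterval, E) := ((0, x₀), cst x₀)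
  have hΨu : Ψ u = 0 := by simp [Ψ, u]
  have hder : fderiv ℝ Ψ u ∘L .inr ℝ (ℝ × E) C(FlowInterval, E) = .id ℝ _ := by
    have h1 : HasFDerivAt Ψ (fderiv ℝ Ψ u) u := (hΨ.differentiable (by simp) u).hasFDerivAt
    have h2 : HasFDerivAt (fun c : C(FlowInterval, E) ↦ Ψ ((0, x₀), c))
        (fderiv ℝ Ψ u ∘L .inr ℝ (ℝ × E) C(FlowInterval, E)) (cst x₀) :=
      HasFDerivAt.comp (cst x₀) h1 (hasFDerivAt_prodMk_right (0, x₀) (cst x₀))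
    have h3 : HasFDerivAt (fun c : C(FlowInterval, E) ↦ Ψ ((0, x₀), c))
        (.id ℝ _) (cst x₀) := by
      have : (fun c : C(FlowInterval, E) ↦ Ψ ((0, x₀), c)) = fun c ↦ c - cst x₀ := by
        funext c; simp [Ψ]
      rw [this]
      exact (hasFDerivAt_id _).sub_const _
    exact h2.unique h3
  have hinv : (fderiv ℝ Ψ u ∘L .inr ℝ (ℝ × E) C(FlowInterval, E)).IsInvertible := by
    rw [hder]; exact ⟨.refl ℝ _, rfl⟩
  have cdf : ContDiffAt ℝ ∞ Ψ u := hΨ.contDiffAt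
  let c := cdf.implicitFunction (by simp) hinv
  have hc : ContDiffAt ℝ ∞ c (0, x₀) := cdf.contDiffAt_implicitFunction (by simp) hinv
  have hc0 : c (0, x₀) = cst x₀ := cdf.implicitFunction_apply_self (by simp) hinv
  have hev : ∀ᶠ p in 𝓝 ((0 : ℝ), x₀), Ψ (p, c p) = 0 := by
    have := cdf.eventually_apply_implicitFunction (by simp) hinv
    rwa [hΨu] at this
  refine ⟨fun p ↦ extendCurve (c p), fun s ↦ ?_, ?_⟩
  · exact (ContinuousMap.evalCLM ℝ (Set.projIcc (-1 : ℝ) 1 (by norm_num) s)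
      : C(FlowInterval, E) →L[ℝ] E).contDiff.contDiffAt.comp _ hc
  obtain ⟨ε, hε, hball⟩ := Metric.mem_nhds_iff.1 hU
  have hnear : ∀ᶠ p in 𝓝 ((0 : ℝ), x₀), dist (c p) (cst x₀) < ε := by
    have := hc.continuousAt.eventually (Metric.ball_mem_nhds (c (0, x₀)) hε)
    rwa [hc0] at this
  filter_upwards [hev, hnear] with p hp hpε
  have hform : ∀ s ∈ Set.Icc (-1 : ℝ) 1, extendCurve (c p) s =
      p.2 + p.1 • ∫ u in (0 : ℝ)..s, f (extendCurve (c p) u) := by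
    intro s hs
    have h1 := DFunLike.congr_fun hp ⟨s, hs⟩
    have h2 : extendCurve (c p) s = c p ⟨s, hs⟩ := by
      rw [extendCurve, Set.projIcc_of_mem _ hs]
    rw [h2]
    have h3 : c p ⟨s, hs⟩ - p.2 - p.1 • ∫ u in (0 : ℝ)..s, f (extendCurve (c p) u) = 0 := h1
    rw [sub_sub, sub_eq_zero] at h3
    exact h3
  refine ⟨by simpa using hform 0 (by norm_num), fun s hs ↦ ⟨hball ?_, ?_⟩⟩
  · exact (ContinuousMap.dist_apply_le_dist (f := c p) (g := cst x₀) _).trans_lt hpε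
  · have hcont : Continuous fun u ↦ f (extendCurve (c p) u) :=
      hf.continuous.comp (continuous_extendCurve _)
    have h1 : HasDerivAt (fun s ↦ p.2 + p.1 • ∫ u in (0 : ℝ)..s, f (extendCurve (c p) u))
        (p.1 • f (extendCurve (c p) s)) s :=
      ((hcont.integral_hasStrictDerivAt 0 s).hasDerivAt.const_smul p.1).const_add p.2
    refine h1.congr_of_eventuallyEq ?_
    filter_upwards [Icc_mem_nhds hs.1 hs.2] with r hr using hform r hr

end LocalFlow

/-! ### Linear algebra of contact forms on an odd-dimensional space. -/

section LinearAlgebra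

variable {V : Type*} [AddCommGroup V] [Module ℝ V]

/-- The product `a(v₀) ∏ d(v₂ᵢ₊₁, v₂ᵢ₊₂)` whose alternatization is `a ∧ dⁿ`. -/
def pairProd (n : ℕ) (a : V →ₗ[ℝ] ℝ) (d : V →ₗ[ℝ] V →ₗ[ℝ] ℝ) (v : Fin (2 * n + 1) → V) : ℝ :=
  a (v ⟨0, by omega⟩) * ∏ i : Fin n, d (v ⟨2 * i + 1, by omega⟩) (v ⟨2 * i + 2, by omega⟩)

theorem fin_two_mul_add_one_cases {n : ℕ} (p : Fin (2 * n + 1)) :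
    p = ⟨0, by omega⟩ ∨ (∃ k : Fin n, p = ⟨2 * k + 1, by omega⟩) ∨
      ∃ k : Fin n, p = ⟨2 * k + 2, by omega⟩ := by
  rcases p with ⟨p, hp⟩
  rcases Nat.eq_zero_or_pos p with h | h
  · left; simp [h]
  · right
    rcases Nat.even_or_odd' p with ⟨k, hk | hk⟩
    · right; exact ⟨⟨k - 1, by omega⟩, by ext; simp only; omega⟩
    · left; exact ⟨⟨k, by omega⟩, by ext; simp only; omega⟩

/-- Each slot occurs in exactly one factor, so the remaining factors act as a scalar. -/
theorem pairProd_update_linear (n : ℕ) (a : V →ₗ[ℝ] ℝ) (d : V →ₗ[ℝ] V →ₗ[ℝ] ℝ)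
    (v : Fin (2 * n + 1) → V) (p : Fin (2 * n + 1)) :
    ∃ l : V →ₗ[ℝ] ℝ, ∀ x, pairProd n a d (Function.update v p x) = l x := by
  rcases fin_two_mul_add_one_cases p with rfl | ⟨k, rfl⟩ | ⟨k, rfl⟩
  · refine ⟨(∏ i : Fin n, d (v ⟨2 * i + 1, by omega⟩) (v ⟨2 * i + 2, by omega⟩)) • a, fun x ↦ ?_⟩
    rw [pairProd, Function.update_self, LinearMap.smul_apply, smul_eq_mul, mul_comm]
    congr 1
  · refine ⟨(a (v ⟨0, by omega⟩) * ∏ i ∈ Finset.univ.erase k,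
      d (v ⟨2 * i + 1, by omega⟩) (v ⟨2 * i + 2, by omega⟩)) • d.flip (v ⟨2 * k + 2, by omega⟩),
      fun x ↦ ?_⟩
    rw [pairProd, ← Finset.mul_prod_erase _ _ (Finset.mem_univ k), Function.update_self,
      Function.update_of_ne (by simp), Function.update_of_ne (by simp), LinearMap.smul_apply,
      smul_eq_mul, LinearMap.flip_apply, mul_left_comm, mul_comm]
    congr 2
    refine Finset.prod_congr rfl fun i hi ↦ ?_
    have hik : (i : ℕ) ≠ k := fun h ↦ (Finset.mem_erase.1 hi).1 (Fin.ext h)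
    rw [Function.update_of_ne (by simpa using hik),
      Function.update_of_ne (by simp only [ne_eq, Fin.mk.injEq]; omega)]
  · refine ⟨(a (v ⟨0, by omega⟩) * ∏ i ∈ Finset.univ.erase k,
      d (v ⟨2 * i + 1, by omega⟩) (v ⟨2 * i + 2, by omega⟩)) • d (v ⟨2 * k + 1, by omega⟩),
      fun x ↦ ?_⟩
    rw [pairProd, ← Finset.mul_prod_erase _ _ (Finset.mem_univ k), Function.update_self,
      Function.update_of_ne (by simp), Function.update_of_ne (by simp), LinearMap.smul_apply,
      smul_eq_mul, mul_left_comm, mul_comm]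
    congr 2
    refine Finset.prod_congr rfl fun i hi ↦ ?_
    have hik : (i : ℕ) ≠ k := fun h ↦ (Finset.mem_erase.1 hi).1 (Fin.ext h)
    rw [Function.update_of_ne (by simp only [ne_eq, Fin.mk.injEq]; omega),
      Function.update_of_ne (by simpa using hik)]

/-- `pairProd` as a multilinear map. -/
def pairProdMultilinear (n : ℕ) (a : V →ₗ[ℝ] ℝ) (d : V →ₗ[ℝ] V →ₗ[ℝ] ℝ) :
    MultilinearMap ℝ (fun _ : Fin (2 * n + 1) ↦ V) ℝ where
  toFun := pairProd n a d
  map_update_add' v p x y := by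
    obtain ⟨l, hl⟩ := pairProd_update_linear n a d v p
    convert! l.map_add x y <;> convert! hl _
  map_update_smul' v p c x := by
    obtain ⟨l, hl⟩ := pairProd_update_linear n a d v p
    convert! l.map_smul c x <;> convert! hl _

theorem pairProd_eq_zero (n : ℕ) (a : V →ₗ[ℝ] ℝ) (d : V →ₗ[ℝ] V →ₗ[ℝ] ℝ) {u : V}
    (ha : a u = 0) (hd : ∀ w, d u w = 0) (hd' : ∀ w, d w u = 0) (v : Fin (2 * n + 1) → V)
    (p : Fin (2 * n + 1)) (hp : v p = u) : pairProd n a d v = 0 := by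
  subst hp
  rcases fin_two_mul_add_one_cases p with rfl | ⟨k, rfl⟩ | ⟨k, rfl⟩
  · rw [pairProd, ha, zero_mul]
  · rw [pairProd, Finset.prod_eq_zero (Finset.mem_univ k) (hd _), mul_zero]
  · rw [pairProd, Finset.prod_eq_zero (Finset.mem_univ k) (hd' _), mul_zero]

variable {n : ℕ} {a : V →ₗ[ℝ] ℝ} {d : V →ₗ[ℝ] V →ₗ[ℝ] ℝ}

theorem skew_of_alternating (hd : ∀ v, d v v = 0) (v w : V) : d v w = -d w v := by
  have h := hd (v + w)
  simp only [map_add, LinearMap.add_apply, hd, zero_add, add_zero] at h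
  linarith

/-- A tuple on which `a ∧ dⁿ` does not vanish is a basis. Replacing its `j`-th vector by `u`
multiplies the value by the `j`-th coordinate of `u`, but every term of the alternating sum then
contains `a u`, `d u _` or `d _ u`, so the value is zero. -/
theorem eq_zero_of_nondegenerate (hV : Module.finrank ℝ V = 2 * n + 1) (hd : ∀ v, d v v = 0)
    (hnd : ∃ v : Fin (2 * n + 1) → V, ∑ σ : Equiv.Perm (Fin (2 * n + 1)),
      ((Equiv.Perm.sign σ : ℤ) : ℝ) * pairProd n a d (v ∘ σ) ≠ 0)
    {u : V} (hau : a u = 0) (hdu : ∀ w, d u w = 0) : u = 0 := by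
  obtain ⟨v, hv⟩ := hnd
  let f := MultilinearMap.alternatization (pairProdMultilinear n a d)
  have hf : ∀ w, f w = ∑ σ : Equiv.Perm (Fin (2 * n + 1)),
      ((Equiv.Perm.sign σ : ℤ) : ℝ) * pairProd n a d (w ∘ σ) := by
    intro w
    rw [MultilinearMap.alternatization_apply]
    refine Finset.sum_congr rfl fun σ _ ↦ ?_
    rw [Units.smul_def, zsmul_eq_mul]
    rfl
  rw [← hf] at hv
  have hli : LinearIndependent ℝ v := by
    by_contra h
    exact hv (f.map_linearDependent v h)
  have : FiniteDimensional ℝ V := FiniteDimensional.of_finrank_pos (by omega)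
  let b := basisOfLinearIndependentOfCardEqFinrank hli (by simp [hV])
  have hb : ∀ i, b i = v i := fun i ↦ by simp [b]
  apply b.repr.map_eq_zero_iff.1
  ext j
  have h1 : f (Function.update v j u) = 0 := by
    rw [hf]
    refine Finset.sum_eq_zero fun σ _ ↦ ?_
    rw [pairProd_eq_zero n a d hau hdu
      (fun w ↦ by rw [skew_of_alternating hd, hdu, neg_zero]) _ (σ.symm j) (by simp), mul_zero]
  have h2 : f (Function.update v j u) = b.repr u j * f v := by
    conv_lhs => rw [← b.sum_repr u]
    rw [f.map_update_sum, Finset.sum_eq_single j]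
    · rw [f.map_update_smul, hb, Function.update_eq_self, smul_eq_mul]
    · intro i _ hij
      rw [f.map_update_smul, hb, f.map_update_self v hij.symm, smul_zero]
    · simp
  rw [h2] at h1
  exact (mul_eq_zero.1 h1).resolve_right hv

/-- A skew-symmetric real matrix of odd size is singular: transposition gives `det A = -det A`. -/
theorem exists_kernel_of_odd (hV : Module.finrank ℝ V = 2 * n + 1) (hd : ∀ v, d v v = 0) :
    ∃ u : V, u ≠ 0 ∧ ∀ w, d u w = 0 := by
  have : FiniteDimensional ℝ V := FiniteDimensional.of_finrank_pos (by omega)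
  let b := Module.finBasisOfFinrankEq ℝ V hV
  let A : Matrix (Fin (2 * n + 1)) (Fin (2 * n + 1)) ℝ := fun i j ↦ d (b i) (b j)
  have hA : A.transpose = -A := by
    ext i j
    exact skew_of_alternating hd _ _
  have hdet : A.det = 0 := by
    have h := A.det_transpose
    rw [hA, Matrix.det_neg, Fintype.card_fin, pow_succ, pow_mul] at h
    norm_num at h
    linarith
  obtain ⟨c, hc, hcA⟩ := Matrix.exists_vecMul_eq_zero_iff.2 hdet
  refine ⟨∑ i, c i • b i, fun h ↦ hc ?_, fun w ↦ ?_⟩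
  · ext i
    have : b.repr (∑ i, c i • b i) i = b.repr 0 i := by rw [h]
    rw [b.repr_sum_self] at this
    simpa using this
  · have : d (∑ i, c i • b i) = 0 := by
      refine b.ext fun j ↦ ?_
      have := congrFun hcA j
      simpa [Matrix.vecMul, dotProduct, A] using this
    rw [this, LinearMap.zero_apply]

/-- A contact form on a vector space has a Reeb vector. -/
theorem exists_reeb_vector (hV : Module.finrank ℝ V = 2 * n + 1) (hd : ∀ v, d v v = 0)
    (hinj : ∀ u, a u = 0 → (∀ w, d u w = 0) → u = 0) :
    ∃ r : V, a r = 1 ∧ ∀ w, d r w = 0 := by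
  obtain ⟨u, hu, hdu⟩ := exists_kernel_of_odd hV hd
  have hau : a u ≠ 0 := fun h ↦ hu (hinj u h hdu)
  exact ⟨(a u)⁻¹ • u, by simp [hau], fun w ↦ by simp [hdu]⟩

end LinearAlgebra

/-! ### Exterior derivative of one-forms on a normed space. -/

section FormD

variable {E : Type*} [NormedAddCommGroup E] [NormedSpace ℝ E]
  {E' : Type*} [NormedAddCommGroup E'] [NormedSpace ℝ E']

/-- The exterior derivative of a one-form on a normed space, as a function of two vectors. -/
noncomputable def formD (a : E → E →L[ℝ] ℝ) (y v w : E) : ℝ :=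
  extDeriv (fun y ↦ ContinuousAlternatingMap.ofSubsingleton ℝ E ℝ (0 : Fin 1) (a y)) y ![v, w]

theorem differentiableAt_ofSubsingleton {a : E → E →L[ℝ] ℝ} {y : E} (ha : DifferentiableAt ℝ a y) :
    DifferentiableAt ℝ
      (fun y ↦ ContinuousAlternatingMap.ofSubsingleton ℝ E ℝ (0 : Fin 1) (a y)) y :=
  (ContinuousAlternatingMap.ofSubsingletonLIE (𝕜 := ℝ) (E := E)
    (F := ℝ) (0 : Fin 1)).toContinuousLinearEquiv.differentiableAt.comp y ha

theorem formD_eq {a : E → E →L[ℝ] ℝ} {y : E} (ha : DifferentiableAt ℝ a y) (v w : E) :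
    formD a y v w = fderiv ℝ a y v w - fderiv ℝ a y w v := by
  rw [formD, extDeriv_apply (differentiableAt_ofSubsingleton ha)]
  have h : ∀ u z : E, fderiv ℝ (fun y ↦ a y u) y z = fderiv ℝ a y z u := fun u z ↦ by
    rw [fderiv_clm_apply ha (differentiableAt_const u)]
    simp
  simp [Fin.sum_univ_two, Fin.removeNth, h, sub_eq_add_neg]

theorem formD_pullback {a : E → E →L[ℝ] ℝ} {g : E' → E} {y : E'}
    (ha : DifferentiableAt ℝ a (g y)) (hg : ContDiffAt ℝ ∞ g y) (v w : E') :
    formD (fun y ↦ (a (g y)).comp (fderiv ℝ g y)) y v w =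
      formD a (g y) (fderiv ℝ g y v) (fderiv ℝ g y w) := by
  have h := extDeriv_pullback (differentiableAt_ofSubsingleton ha) hg
    (by rw [minSmoothness_of_isRCLikeNormedField]; exact WithTop.coe_le_coe.2 le_top)
  have h' := DFunLike.congr_fun h ![v, w]
  rw [formD, formD]
  convert! h' using 1
  simp only [ContinuousAlternatingMap.compContinuousLinearMap_apply]
  congr 1
  ext i
  fin_cases i <;> rfl

theorem formD_congr {a b : E → E →L[ℝ] ℝ} {y : E} (h : a =ᶠ[𝓝 y] b) (v w : E) :
    formD a y v w = formD b y v w := by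
  rw [formD, formD, Filter.EventuallyEq.extDeriv_eq]
  filter_upwards [h] with z hz
  rw [hz]

end FormD

/-! ### One-forms and their exterior derivatives in charts. -/

section Charts

variable {E : Type*} [NormedAddCommGroup E] [NormedSpace ℝ E]
  {M : Type*} [TopologicalSpace M] [ChartedSpace E M] [IsManifold 𝓘(ℝ, E) ∞ M]

/-- A one-form as a function on the tangent bundle. -/
noncomputable def OneForm.eval (α : OneForm E M) (p : TangentBundle 𝓘(ℝ, E) M) : ℝ := α p.1 p.2

theorem OneForm.IsSmooth.contMDiff_eval {α : OneForm E M} (hα : α.IsSmooth) :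
    ContMDiff (𝓘(ℝ, E).prod 𝓘(ℝ, E)) 𝓘(ℝ, ℝ) ∞ α.eval := by
  have h1 : ContMDiff (𝓘(ℝ, E).prod 𝓘(ℝ, E)) (𝓘(ℝ, E).prod 𝓘(ℝ, E →L[ℝ] ℝ)) ∞
      (fun p : TangentBundle 𝓘(ℝ, E) M ↦ Bundle.TotalSpace.mk' (E →L[ℝ] ℝ)
        (E := fun x : M ↦ TangentSpace 𝓘(ℝ, E) x →L[ℝ] ℝ) p.1 (α p.1)) :=
    ContMDiff.comp hα (Bundle.contMDiff_proj (TangentSpace 𝓘(ℝ, E) : M → Type _))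
  have h2 : ContMDiff (𝓘(ℝ, E).prod 𝓘(ℝ, E)) (𝓘(ℝ, E).prod 𝓘(ℝ, E)) ∞
      (fun p : TangentBundle 𝓘(ℝ, E) M ↦ Bundle.TotalSpace.mk' E (E := (TangentSpace 𝓘(ℝ, E) : M → Type _))
        p.1 p.2) := contMDiff_id
  intro p
  have h3 := ContMDiffAt.clm_bundle_apply (F₂ := ℝ) (E₂ := fun _ : M ↦ ℝ) (b := fun p : TangentBundle 𝓘(ℝ, E) M ↦ p.1)
    (v := fun p : TangentBundle 𝓘(ℝ, E) M ↦ p.2)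
    (ϕ := fun p : TangentBundle 𝓘(ℝ, E) M ↦ α p.1) (h1 p) (h2 p)
  exact (Bundle.contMDiffAt_totalSpace.1 h3).2

/-- In finite dimension it suffices to test on constant vectors; there the form is evaluated on the
tangent map of the inverse chart. -/
theorem contDiffOn_inChart [FiniteDimensional ℝ E] {α : OneForm E M} (hα : α.IsSmooth) (x₀ : M) :
    ContDiffOn ℝ ∞ (α.inChart x₀) (extChartAt 𝓘(ℝ, E) x₀).target := by
  rw [contDiffOn_clm_apply]
  intro v
  rw [← contMDiffOn_iff_contDiffOn]
  have hs : UniqueMDiffOn 𝓘(ℝ, E) (extChartAt 𝓘(ℝ, E) x₀).target :=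
    (isOpen_extChartAt_target (I := 𝓘(ℝ, E)) x₀).uniqueMDiffOn
  have h1 := (contMDiffOn_extChartAt_symm (I := 𝓘(ℝ, E)) (n := ∞) x₀).contMDiffOn_tangentMapWithin
    (m := ∞) le_rfl hs
  have h2 : ContMDiffOn 𝓘(ℝ, E) (𝓘(ℝ, E).prod 𝓘(ℝ, E)) ∞ (fun y : E ↦ (⟨y, v⟩ : TangentBundle 𝓘(ℝ, E) E))
      (extChartAt 𝓘(ℝ, E) x₀).target :=
    fun y _ ↦ ((contMDiffAt_vectorSpace_iff_contDiffAt (V := fun _ : E ↦ v)).2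
      contDiffAt_const).contMDiffWithinAt
  have h3 := hα.contMDiff_eval.comp_contMDiffOn (h1.comp h2 fun y hy ↦ hy)
  refine h3.congr fun y hy ↦ ?_
  simp only [Function.comp_apply, OneForm.eval, tangentMapWithin,
    mfderivWithin_of_isOpen (isOpen_extChartAt_target (I := 𝓘(ℝ, E)) x₀) hy]
  rfl

theorem differentiableAt_inChart [FiniteDimensional ℝ E] {α : OneForm E M} (hα : α.IsSmooth)
    (x₀ : M) {y : E} (hy : y ∈ (extChartAt 𝓘(ℝ, E) x₀).target) :
    DifferentiableAt ℝ (α.inChart x₀) y :=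
  ((contDiffOn_inChart hα x₀).contDiffAt ((isOpen_extChartAt_target (I := 𝓘(ℝ, E)) x₀).mem_nhds hy)).differentiableAt
    (by simp)

/-- The derivative of a chart. -/
noncomputable def chartD (x₀ x : M) : TangentSpace 𝓘(ℝ, E) x →L[ℝ] E :=
  mfderiv 𝓘(ℝ, E) 𝓘(ℝ, E) (extChartAt 𝓘(ℝ, E) x₀) x

/-- The derivative of the inverse of a chart. -/
noncomputable def chartDSymm (x₀ : M) (y : E) :
    E →L[ℝ] TangentSpace 𝓘(ℝ, E) ((extChartAt 𝓘(ℝ, E) x₀).symm y) :=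
  mfderiv 𝓘(ℝ, E) 𝓘(ℝ, E) (extChartAt 𝓘(ℝ, E) x₀).symm y

theorem mfderiv_symm_mfderiv {x₀ x : M} (hx : x ∈ (extChartAt 𝓘(ℝ, E) x₀).source)
    (v : TangentSpace 𝓘(ℝ, E) x) :
    chartDSymm x₀ (extChartAt 𝓘(ℝ, E) x₀ x) (chartD x₀ x v) = v := by
  have : IsManifold 𝓘(ℝ, E) 1 M := IsManifold.of_le (n := ∞) (by simp)
  have h := mfderivWithin_extChartAt_symm_comp_mfderiv_extChartAt' hx
  rw [modelWithCornersSelf_coe, Set.range_id, mfderivWithin_univ] at h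
  exact DFunLike.congr_fun h v

theorem mfderiv_mfderiv_symm {x₀ : M} {y : E} (hy : y ∈ (extChartAt 𝓘(ℝ, E) x₀).target) (v : E) :
    chartD x₀ ((extChartAt 𝓘(ℝ, E) x₀).symm y) (chartDSymm x₀ y v) = v := by
  have : IsManifold 𝓘(ℝ, E) 1 M := IsManifold.of_le (n := ∞) (by simp)
  have h := mfderiv_extChartAt_comp_mfderivWithin_extChartAt_symm hy
  rw [modelWithCornersSelf_coe, Set.range_id, mfderivWithin_univ] at h
  exact DFunLike.congr_fun h v

theorem inChart_mfderiv (α : OneForm E M) {x₀ x : M} (hx : x ∈ (extChartAt 𝓘(ℝ, E) x₀).source)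
    (v : TangentSpace 𝓘(ℝ, E) x) :
    α.inChart x₀ (extChartAt 𝓘(ℝ, E) x₀ x) (chartD x₀ x v) = α x v := by
  have h : α.inChart x₀ (extChartAt 𝓘(ℝ, E) x₀ x) (chartD x₀ x v) =
    α ((extChartAt 𝓘(ℝ, E) x₀).symm (extChartAt 𝓘(ℝ, E) x₀ x))
      (chartDSymm x₀ (extChartAt 𝓘(ℝ, E) x₀ x) (chartD x₀ x v)) := rfl
  rw [h, mfderiv_symm_mfderiv hx]
  congr 2
  exact (extChartAt 𝓘(ℝ, E) x₀).left_inv hx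

theorem mdifferentiableAt_chart {x₀ x : M} (hx : x ∈ (extChartAt 𝓘(ℝ, E) x₀).source) :
    MDifferentiableAt 𝓘(ℝ, E) 𝓘(ℝ, E) (extChartAt 𝓘(ℝ, E) x₀) x := by
  have : IsManifold 𝓘(ℝ, E) 1 M := IsManifold.of_le (n := ∞) (by simp)
  exact mdifferentiableAt_extChartAt (by rwa [extChartAt_source] at hx)

theorem mdifferentiableAt_chart_symm {x₀ : M} {y : E} (hy : y ∈ (extChartAt 𝓘(ℝ, E) x₀).target) :
    MDifferentiableAt 𝓘(ℝ, E) 𝓘(ℝ, E) (extChartAt 𝓘(ℝ, E) x₀).symm y :=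
  ((contMDiffOn_extChartAt_symm (n := ∞) x₀).contMDiffAt
    ((isOpen_extChartAt_target (I := 𝓘(ℝ, E)) x₀).mem_nhds hy)).mdifferentiableAt (by simp)

/-- The expressions of a one-form in two charts differ by pullback under the transition map. -/
theorem inChart_change (α : OneForm E M) {x₀ x : M} {y : E} (hy : y ∈ (extChartAt 𝓘(ℝ, E) x).target)
    (hy' : (extChartAt 𝓘(ℝ, E) x).symm y ∈ (extChartAt 𝓘(ℝ, E) x₀).source) :
    α.inChart x y = (α.inChart x₀ ((extChartAt 𝓘(ℝ, E) x₀ ∘ (extChartAt 𝓘(ℝ, E) x).symm) y)).comp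
      (fderiv ℝ (extChartAt 𝓘(ℝ, E) x₀ ∘ (extChartAt 𝓘(ℝ, E) x).symm) y) := by
  ext v
  have h : fderiv ℝ (extChartAt 𝓘(ℝ, E) x₀ ∘ (extChartAt 𝓘(ℝ, E) x).symm) y v =
      chartD x₀ ((extChartAt 𝓘(ℝ, E) x).symm y) (chartDSymm x y v) := by
    rw [← mfderiv_eq_fderiv, mfderiv_comp y (mdifferentiableAt_chart hy')
      (mdifferentiableAt_chart_symm hy)]
    rfl
  rw [ContinuousLinearMap.comp_apply, h, Function.comp_apply, inChart_mfderiv α hy']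
  rfl

/-- The exterior derivative can be computed in any chart. -/
theorem d_eq_formD [FiniteDimensional ℝ E] {α : OneForm E M} (hα : α.IsSmooth) {x₀ x : M}
    (hx : x ∈ (extChartAt 𝓘(ℝ, E) x₀).source) (v w : TangentSpace 𝓘(ℝ, E) x) :
    α.d x v w = formD (α.inChart x₀) (extChartAt 𝓘(ℝ, E) x₀ x)
      (chartD x₀ x v) (chartD x₀ x w) := by
  set e := extChartAt 𝓘(ℝ, E) x
  set e₀ := extChartAt 𝓘(ℝ, E) x₀
  have hxe : x ∈ e.source := mem_extChartAt_source x
  have hback : e.symm (e x) = x := e.left_inv hxe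
  have hy : e x ∈ e.target := e.map_source hxe
  have hg : ContDiffAt ℝ ∞ (e₀ ∘ e.symm) (e x) := by
    rw [← contMDiffAt_iff_contDiffAt]
    refine ContMDiffAt.comp (I' := 𝓘(ℝ, E)) _ ?_ ((contMDiffOn_extChartAt_symm (n := ∞) x).contMDiffAt
      ((isOpen_extChartAt_target (I := 𝓘(ℝ, E)) x).mem_nhds hy))
    refine contMDiffAt_extChartAt' ?_
    rw [hback]
    rwa [extChartAt_source] at hx
  have hnear : α.inChart x =ᶠ[𝓝 (e x)] fun y ↦ (α.inChart x₀ ((e₀ ∘ e.symm) y)).comp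
      (fderiv ℝ (e₀ ∘ e.symm) y) := by
    have h1 : ∀ᶠ y in 𝓝 (e x), y ∈ e.target := (isOpen_extChartAt_target (I := 𝓘(ℝ, E)) x).mem_nhds hy
    have h2 : ∀ᶠ y in 𝓝 (e x), e.symm y ∈ e₀.source := by
      refine (continuousAt_extChartAt_symm x).eventually ?_
      rw [hback]
      exact (isOpen_extChartAt_source x₀).mem_nhds hx
    filter_upwards [h1, h2] with y hy hy' using inChart_change α hy hy'
  have hgx : (e₀ ∘ e.symm) (e x) = e₀ x := by rw [Function.comp_apply, hback]
  have hD : ∀ u : TangentSpace 𝓘(ℝ, E) x, fderiv ℝ (e₀ ∘ e.symm) (e x) (chartD x x u) = chartD x₀ x u := by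
    intro u
    have h1 : MDifferentiableAt 𝓘(ℝ, E) 𝓘(ℝ, E) (e₀ ∘ e.symm) (e x) :=
      (hg.differentiableAt (by simp)).mdifferentiableAt
    have h2 := mfderiv_comp_apply x h1 (mdifferentiableAt_chart hxe) u
    rw [← mfderiv_eq_fderiv]
    refine h2.symm.trans ?_
    have h3 : (e₀ ∘ e.symm) ∘ e =ᶠ[𝓝 x] e₀ := by
      filter_upwards [(isOpen_extChartAt_source (I := 𝓘(ℝ, E)) x).mem_nhds hxe] with z hz
      simp only [Function.comp_apply, e.left_inv hz, e]
    rw [h3.mfderiv_eq]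
    rfl
  have h4 : α.d x v w = formD (α.inChart x) (e x) (chartD x x v) (chartD x x w) := rfl
  rw [h4, formD_congr hnear, formD_pullback _ hg, hgx, hD, hD]
  rw [hgx]
  exact differentiableAt_inChart hα x₀ (e₀.map_source hx)

end Charts

/-! ### Existence, uniqueness and smoothness of the Reeb field. -/

section Reeb

variable {E : Type*} [NormedAddCommGroup E] [NormedSpace ℝ E] [FiniteDimensional ℝ E]
  {M : Type*} [TopologicalSpace M] [ChartedSpace E M] [IsManifold 𝓘(ℝ, E) ∞ M]

/-- The exterior derivative at a point as a bilinear map. -/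
noncomputable def OneForm.IsSmooth.dBilin {α : OneForm E M} (hα : α.IsSmooth) (x : M) :
    TangentSpace 𝓘(ℝ, E) x →ₗ[ℝ] TangentSpace 𝓘(ℝ, E) x →ₗ[ℝ] ℝ :=
  have h : ∀ v w, α.d x v w = _ := fun v w ↦
    (d_eq_formD hα (mem_extChartAt_source x) v w).trans (formD_eq (differentiableAt_inChart hα x
      ((extChartAt 𝓘(ℝ, E) x).map_source (mem_extChartAt_source x))) _ _)
  LinearMap.mk₂ ℝ (α.d x)
    (fun u v w ↦ by simp only [h, map_add, add_apply]; ring)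
    (fun c v w ↦ by
      simp only [h, map_smul, smul_apply, smul_eq_mul]; ring)
    (fun u v w ↦ by simp only [h, map_add, add_apply]; ring)
    (fun c v w ↦ by
      simp only [h, map_smul, smul_apply, smul_eq_mul]; ring)

theorem dBilin_apply {α : OneForm E M} (hα : α.IsSmooth) (x : M) (v w : TangentSpace 𝓘(ℝ, E) x) :
    hα.dBilin x v w = α.d x v w := rfl

theorem d_eq {α : OneForm E M} (hα : α.IsSmooth) {x₀ x : M}
    (hx : x ∈ (extChartAt 𝓘(ℝ, E) x₀).source) (v w : TangentSpace 𝓘(ℝ, E) x) :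
    α.d x v w =
      fderiv ℝ (α.inChart x₀) (extChartAt 𝓘(ℝ, E) x₀ x) (chartD x₀ x v) (chartD x₀ x w) -
      fderiv ℝ (α.inChart x₀) (extChartAt 𝓘(ℝ, E) x₀ x) (chartD x₀ x w) (chartD x₀ x v) :=
  (d_eq_formD hα hx v w).trans (formD_eq (differentiableAt_inChart hα x₀
    ((extChartAt 𝓘(ℝ, E) x₀).map_source hx)) _ _)

theorem d_self {α : OneForm E M} (hα : α.IsSmooth) (x : M) (v : TangentSpace 𝓘(ℝ, E) x) :
    α.d x v v = 0 := by
  rw [d_eq hα (mem_extChartAt_source x), sub_self]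

variable {n : ℕ} {ξ : Distribution E M} {α : OneForm E M}

theorem IsContactForm.eq_zero_of_forall (hα : IsContactForm n ξ α)
    (hE : Module.finrank ℝ E = 2 * n + 1) {x : M} {u : TangentSpace 𝓘(ℝ, E) x}
    (hau : α x u = 0) (hdu : ∀ w, α.d x u w = 0) : u = 0 :=
  eq_zero_of_nondegenerate (V := TangentSpace 𝓘(ℝ, E) x) (n := n)
    (a := (α x : TangentSpace 𝓘(ℝ, E) x →ₗ[ℝ] ℝ))
    (d := hα.smooth.dBilin x) hE (d_self hα.smooth x) (hα.nondegenerate x) hau hdu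

theorem IsContactForm.exists_isReebField (hα : IsContactForm n ξ α)
    (hE : Module.finrank ℝ E = 2 * n + 1) :
    ∃ R : ∀ x : M, TangentSpace 𝓘(ℝ, E) x, IsReebField α R := by
  have h : ∀ x, ∃ r : TangentSpace 𝓘(ℝ, E) x, α x r = 1 ∧ ∀ w, α.d x r w = 0 := fun x ↦
    exists_reeb_vector (V := TangentSpace 𝓘(ℝ, E) x) (n := n)
      (a := (α x : TangentSpace 𝓘(ℝ, E) x →ₗ[ℝ] ℝ))
      (d := hα.smooth.dBilin x) hE (d_self hα.smooth x)
      (fun _ hau hdu ↦ hα.eq_zero_of_forall hE hau hdu)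
  choose R hR using h
  exact ⟨R, hR⟩

theorem IsContactForm.isReebField_unique (hα : IsContactForm n ξ α)
    (hE : Module.finrank ℝ E = 2 * n + 1) {R R' : ∀ x : M, TangentSpace 𝓘(ℝ, E) x}
    (hR : IsReebField α R) (hR' : IsReebField α R') : R = R' := by
  funext x
  refine sub_eq_zero.1 (hα.eq_zero_of_forall hE ?_ fun w ↦ ?_)
  · rw [map_sub, (hR x).1, (hR' x).1, sub_self]
  · rw [← dBilin_apply hα.smooth, map_sub, LinearMap.sub_apply, dBilin_apply, dBilin_apply,
      (hR x).2, (hR' x).2, sub_self]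

/-- The map `v ↦ a(v) a + da(v, ·)` attached to a one-form `a` on a normed space. -/
noncomputable def reebOp (a : E → E →L[ℝ] ℝ) (y : E) : E →L[ℝ] E →L[ℝ] ℝ :=
  (a y).smulRight (a y) + (fderiv ℝ a y - (fderiv ℝ a y).flip)

omit [FiniteDimensional ℝ E] in
theorem reebOp_apply (a : E → E →L[ℝ] ℝ) (y v w : E) :
    reebOp a y v w = a y v * a y w + (fderiv ℝ a y v w - fderiv ℝ a y w v) := by
  simp [reebOp]

theorem reebOp_inChart (hα : α.IsSmooth) {x₀ x : M}
    (hx : x ∈ (extChartAt 𝓘(ℝ, E) x₀).source) (v w : TangentSpace 𝓘(ℝ, E) x) :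
    reebOp (α.inChart x₀) (extChartAt 𝓘(ℝ, E) x₀ x) (chartD x₀ x v) (chartD x₀ x w) =
      α x v * α x w + α.d x v w := by
  rw [reebOp_apply, inChart_mfderiv α hx, inChart_mfderiv α hx, d_eq hα hx]

omit [FiniteDimensional ℝ E] in
theorem chartD_surjective {x₀ x : M} (hx : x ∈ (extChartAt 𝓘(ℝ, E) x₀).source) (u : E) :
    ∃ v, chartD x₀ x v = u := by
  have h := mfderiv_mfderiv_symm ((extChartAt 𝓘(ℝ, E) x₀).map_source hx) u
  rw [(extChartAt 𝓘(ℝ, E) x₀).left_inv hx] at h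
  exact ⟨_, h⟩

/-- For a kernel vector `v`, pairing with `v` itself leaves `α(v)² = 0`, since `dα(v, v) = 0`; then
`dα(v, ·) = 0` as well, so nondegeneracy gives `v = 0`. Equality of dimensions upgrades injectivity
to invertibility. -/
theorem IsContactForm.reebOp_isInvertible (hα : IsContactForm n ξ α)
    (hE : Module.finrank ℝ E = 2 * n + 1) {x₀ x : M}
    (hx : x ∈ (extChartAt 𝓘(ℝ, E) x₀).source) :
    (reebOp (α.inChart x₀) (extChartAt 𝓘(ℝ, E) x₀ x)).IsInvertible := by
  set B := reebOp (α.inChart x₀) (extChartAt 𝓘(ℝ, E) x₀ x) with hB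
  have hinj : Function.Injective (B : E →ₗ[ℝ] E →L[ℝ] ℝ) := by
    rw [← LinearMap.ker_eq_bot, LinearMap.ker_eq_bot']
    intro u hu
    obtain ⟨v, rfl⟩ := chartD_surjective hx u
    have h : ∀ w, α x v * α x w + α.d x v w = 0 := fun w ↦ by
      rw [← reebOp_inChart hα.smooth hx]
      exact DFunLike.congr_fun hu _
    have hv : α x v = 0 := by
      have := h v
      rw [d_self hα.smooth, add_zero] at this
      exact mul_self_eq_zero.1 this
    have hd : ∀ w, α.d x v w = 0 := fun w ↦ by
      have := h w
      rwa [hv, zero_mul, zero_add] at this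
    rw [hα.eq_zero_of_forall hE hv hd, map_zero]
  have hdim : Module.finrank ℝ E = Module.finrank ℝ (E →L[ℝ] ℝ) := by
    rw [← (LinearMap.toContinuousLinearMap (𝕜 := ℝ) (E := E) (F' := ℝ)).finrank_eq]
    exact (Subspace.dual_finrank_eq (K := ℝ) (V := E)).symm
  exact ⟨(LinearEquiv.ofInjectiveOfFinrankEq (B : E →ₗ[ℝ] E →L[ℝ] ℝ) hinj
    hdim).toContinuousLinearEquiv, by ext; rfl⟩

theorem contDiffAt_reebOp {a : E → E →L[ℝ] ℝ} {y : E} (ha : ContDiffAt ℝ ∞ a y) :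
    ContDiffAt ℝ ∞ (reebOp a) y := by
  have hd : ContDiffAt ℝ ∞ (fderiv ℝ a) y := ha.fderiv_right (m := ∞) le_rfl
  have hf : ContDiffAt ℝ ∞ (fun y ↦ (fderiv ℝ a y).flip) y :=
    ContDiffAt.comp (g := fun L : E →L[ℝ] E →L[ℝ] ℝ ↦ L.flip) y
      (contDiff_clm_apply_iff.2 fun v ↦ contDiff_clm_apply_iff.2 fun w ↦ by
        simp only [ContinuousLinearMap.flip_apply]; fun_prop).contDiffAt hd
  exact (ha.smulRight ha).add (hd.sub hf)

omit [FiniteDimensional ℝ E] in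
theorem contMDiffAt_vectorField_iff {v : ∀ x : M, TangentSpace 𝓘(ℝ, E) x} {x₀ x : M}
    (hx : x ∈ (extChartAt 𝓘(ℝ, E) x₀).source) :
    ContMDiffAt 𝓘(ℝ, E) (𝓘(ℝ, E).prod 𝓘(ℝ, E)) ∞
      (fun x ↦ (⟨x, v x⟩ : TangentBundle 𝓘(ℝ, E) M)) x ↔
    ContMDiffAt 𝓘(ℝ, E) 𝓘(ℝ, E) ∞ (fun x ↦ chartD x₀ x (v x)) x := by
  have : IsManifold 𝓘(ℝ, E) 1 M := IsManifold.of_le (n := ∞) (by simp)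
  rw [extChartAt_source] at hx
  rw [(trivializationAt E (TangentSpace 𝓘(ℝ, E) : M → Type _) x₀).contMDiffAt_section_iff
    (by simpa using hx)]
  refine Filter.EventuallyEq.contMDiffAt_iff ?_
  filter_upwards [(chartAt E x₀).open_source.mem_nhds hx] with z hz
  have h := TangentBundle.continuousLinearMapAt_trivializationAt (I := 𝓘(ℝ, E)) hz
  rw [chartD, ← h, Bundle.Trivialization.continuousLinearMapAt_apply,
    Bundle.Trivialization.coe_linearMapAt_of_mem _ (by simpa using hz)]

/-- In a chart the Reeb conditions say that `reebOp` sends `R` to the form itself. So `R` is the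
inverse operator applied to the form, and inversion of operators is smooth. -/
theorem IsContactForm.contMDiff_reebField (hα : IsContactForm n ξ α)
    (hE : Module.finrank ℝ E = 2 * n + 1) {R : ∀ x : M, TangentSpace 𝓘(ℝ, E) x}
    (hR : IsReebField α R) :
    ContMDiff 𝓘(ℝ, E) (𝓘(ℝ, E).prod 𝓘(ℝ, E)) ∞
      (fun x ↦ (⟨x, R x⟩ : TangentBundle 𝓘(ℝ, E) M)) := by
  intro x₀
  rw [contMDiffAt_vectorField_iff (mem_extChartAt_source x₀)]
  set e := extChartAt 𝓘(ℝ, E) x₀ with he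
  have hx₀ : x₀ ∈ e.source := mem_extChartAt_source x₀
  have hy₀ : e x₀ ∈ e.target := e.map_source hx₀
  have hcoord : ∀ x ∈ e.source, chartD x₀ x (R x) =
      (reebOp (α.inChart x₀) (e x)).inverse (α.inChart x₀ (e x)) := by
    intro x hx
    have hinv := hα.reebOp_isInvertible hE hx
    have h1 : reebOp (α.inChart x₀) (e x) (chartD x₀ x (R x)) = α.inChart x₀ (e x) := by
      ext u
      obtain ⟨w, rfl⟩ := chartD_surjective hx u
      rw [reebOp_inChart hα.smooth hx, (hR x).1, (hR x).2, inChart_mfderiv α hx]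
      ring
    rw [← h1, hinv.inverse_apply_self]
  have ha : ContDiffAt ℝ ∞ (α.inChart x₀) (e x₀) :=
    (contDiffOn_inChart hα.smooth x₀).contDiffAt ((isOpen_extChartAt_target x₀).mem_nhds hy₀)
  have hinv : ContDiffAt ℝ ∞ (fun y ↦ (reebOp (α.inChart x₀) y).inverse) (e x₀) := by
    obtain ⟨B, hB⟩ := hα.reebOp_isInvertible hE hx₀
    have h := contDiffAt_map_inverse (𝕜 := ℝ) (n := ∞) B
    rw [hB] at h
    exact h.comp (e x₀) (contDiffAt_reebOp ha)
  have h1 : ContMDiffAt 𝓘(ℝ, E) 𝓘(ℝ, E) ∞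
      (fun x ↦ (reebOp (α.inChart x₀) (e x)).inverse (α.inChart x₀ (e x))) x₀ :=
    ContMDiffAt.comp (I' := 𝓘(ℝ, E)) x₀ (hinv.clm_apply ha).contMDiffAt contMDiffAt_extChartAt
  refine h1.congr_of_eventuallyEq ?_
  filter_upwards [(isOpen_extChartAt_source x₀).mem_nhds hx₀] with x hx using hcoord x hx

end Reeb

/-! ### Completeness and joint smoothness of flows on compact manifolds. -/

section Flow

variable {E : Type*} [NormedAddCommGroup E] [NormedSpace ℝ E] [FiniteDimensional ℝ E]
  {M : Type*} [TopologicalSpace M] [ChartedSpace E M] [IsManifold 𝓘(ℝ, E) ∞ M]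

/-- Near a point, a smooth map on an open set agrees with a globally defined smooth map. -/
theorem exists_contDiff_eventuallyEq {F : Type*} [NormedAddCommGroup F] [NormedSpace ℝ F]
    {g : E → F} {s : Set E} (hs : IsOpen s) (hg : ContDiffOn ℝ ∞ g s) {y₀ : E} (hy₀ : y₀ ∈ s) :
    ∃ f : E → F, ContDiff ℝ ∞ f ∧ f =ᶠ[𝓝 y₀] g := by
  obtain ⟨r, hr, hball⟩ := Metric.nhds_basis_closedBall.mem_iff.1 (hs.mem_nhds hy₀)
  let χ : ContDiffBump y₀ := ⟨r / 2, r, by positivity, by linarith⟩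
  refine ⟨fun y ↦ χ y • g y, ?_, ?_⟩
  · rw [contDiff_iff_contDiffAt]
    intro y
    by_cases hy : y ∈ tsupport χ
    · rw [χ.tsupport_eq] at hy
      exact χ.contDiff.contDiffAt.smul (hg.contDiffAt (hs.mem_nhds (hball hy)))
    · have h0 : (fun y ↦ χ y • g y) =ᶠ[𝓝 y] fun _ ↦ 0 := by
        filter_upwards [notMem_tsupport_iff_eventuallyEq.1 hy] with z hz
        rw [hz, Pi.zero_apply, zero_smul]
      exact contDiffAt_const.congr_of_eventuallyEq h0
  · filter_upwards [χ.eventuallyEq_one] with y hy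
    rw [hy, Pi.one_apply, one_smul]

variable {v : ∀ x : M, TangentSpace 𝓘(ℝ, E) x}

omit [FiniteDimensional ℝ E] in
theorem contDiffOn_vectorField_inChart (hv : ContMDiff 𝓘(ℝ, E) (𝓘(ℝ, E).prod 𝓘(ℝ, E)) ∞
      (fun x ↦ (⟨x, v x⟩ : TangentBundle 𝓘(ℝ, E) M))) (x₀ : M) :
    ContDiffOn ℝ ∞ (fun y ↦ chartD x₀ ((extChartAt 𝓘(ℝ, E) x₀).symm y)
      (v ((extChartAt 𝓘(ℝ, E) x₀).symm y))) (extChartAt 𝓘(ℝ, E) x₀).target := by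
  rw [← contMDiffOn_iff_contDiffOn]
  have h : ContMDiffOn 𝓘(ℝ, E) 𝓘(ℝ, E) ∞ (fun x ↦ chartD x₀ x (v x))
      (extChartAt 𝓘(ℝ, E) x₀).source := fun x hx ↦
    ((contMDiffAt_vectorField_iff hx).1 (hv x)).contMDiffWithinAt
  exact h.comp (contMDiffOn_extChartAt_symm x₀) fun y hy ↦
    (extChartAt 𝓘(ℝ, E) x₀).map_target hy

/-- A smooth vector field has, near any point, integral curves depending smoothly on the initial
value and on the time scale. -/
theorem exists_smooth_family_isMIntegralCurveOn
    (hv : ContMDiff 𝓘(ℝ, E) (𝓘(ℝ, E).prod 𝓘(ℝ, E)) ∞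
      (fun x ↦ (⟨x, v x⟩ : TangentBundle 𝓘(ℝ, E) M))) (x₀ : M) :
    ∃ c : ℝ × M → ℝ → M,
      (ContMDiffAt (𝓘(ℝ, ℝ).prod 𝓘(ℝ, E)) 𝓘(ℝ, E) ∞ (fun p ↦ c p (1 / 2)) (0, x₀)) ∧
      ∀ᶠ p in 𝓝 ((0 : ℝ), x₀), c p 0 = p.2 ∧
        IsMIntegralCurveOn (I := 𝓘(ℝ, E)) (c p) (p.1 • v) (Set.Ioo (-1) 1) := by
  have : CompleteSpace E := FiniteDimensional.complete ℝ E
  set e := extChartAt 𝓘(ℝ, E) x₀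
  have hx₀ : x₀ ∈ e.source := mem_extChartAt_source x₀
  have hy₀ : e x₀ ∈ e.target := e.map_source hx₀
  -- The Banach space result needs a field on all of `E`, so the coordinate field is cut off by a
  -- bump function. The curves are then confined to the set where the two fields agree.
  obtain ⟨f, hf, hfv⟩ := exists_contDiff_eventuallyEq (isOpen_extChartAt_target x₀)
    (contDiffOn_vectorField_inChart hv x₀) hy₀
  obtain ⟨c, hc, hcp⟩ := exists_smooth_family_integralCurves f hf (e x₀)
    {y | f y = chartD x₀ (e.symm y) (v (e.symm y)) ∧ y ∈ e.target}
    (hfv.and ((isOpen_extChartAt_target x₀).mem_nhds hy₀))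
  have hmap : ContMDiffAt (𝓘(ℝ, ℝ).prod 𝓘(ℝ, E)) 𝓘(ℝ, ℝ × E) ∞
      (fun p : ℝ × M ↦ (p.1, e p.2)) (0, x₀) :=
    contMDiffAt_fst.prodMk_space (ContMDiffAt.comp (I' := 𝓘(ℝ, E)) _ contMDiffAt_extChartAt
      contMDiffAt_snd)
  have hcp' := hmap.continuousAt.eventually hcp
  refine ⟨fun p s ↦ e.symm (c (p.1, e p.2) s), ?_, ?_⟩
  · have h2 : ContMDiffAt (𝓘(ℝ, ℝ).prod 𝓘(ℝ, E)) 𝓘(ℝ, E) ∞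
        (fun p : ℝ × M ↦ c (p.1, e p.2) (1 / 2)) (0, x₀) :=
      ContMDiffAt.comp (I' := 𝓘(ℝ, ℝ × E)) (g := fun q : ℝ × E ↦ c q (1 / 2)) (0, x₀)
        (hc (1 / 2)).contMDiffAt hmap
    refine ContMDiffAt.comp (I' := 𝓘(ℝ, E)) _ ?_ h2
    refine (contMDiffOn_extChartAt_symm x₀).contMDiffAt
      ((isOpen_extChartAt_target x₀).mem_nhds ?_)
    exact (hcp'.self_of_nhds.2 (1 / 2) (by norm_num)).1.2
  · have hsrc : ∀ᶠ p : ℝ × M in 𝓝 ((0 : ℝ), x₀), p.2 ∈ e.source :=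
      continuousAt_snd.eventually ((isOpen_extChartAt_source x₀).mem_nhds hx₀)
    filter_upwards [hcp', hsrc] with p hp hpsrc
    refine ⟨by rw [hp.1]; exact e.left_inv hpsrc, fun s hs ↦ ?_⟩
    obtain ⟨⟨hfs, htgt⟩, hder⟩ := hp.2 s hs
    have h1 : HasMFDerivAt 𝓘(ℝ, E) 𝓘(ℝ, E) e.symm (c (p.1, e p.2) s)
        (chartDSymm x₀ (c (p.1, e p.2) s)) := (mdifferentiableAt_chart_symm htgt).hasMFDerivAt
    have h2 := HasMFDerivAt.comp (I' := 𝓘(ℝ, E)) s h1 hder.hasFDerivAt.hasMFDerivAt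
    refine (h2.congr_mfderiv ?_).hasMFDerivWithinAt
    ext
    have h3 := mfderiv_symm_mfderiv (e.map_target htgt) (v (e.symm (c (p.1, e p.2) s)))
    rw [e.right_inv htgt] at h3
    change chartDSymm x₀ _ ((1 : ℝ) • (p.1 • f (c (p.1, e p.2) s))) =
      (1 : ℝ) • (p.1 • v (e.symm (c (p.1, e p.2) s)))
    rw [one_smul, one_smul, map_smul, hfs]
    exact congrArg (p.1 • ·) h3

section Global

variable [T2Space M] (hv : ContMDiff 𝓘(ℝ, E) (𝓘(ℝ, E).prod 𝓘(ℝ, E)) ∞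
      (fun x ↦ (⟨x, v x⟩ : TangentBundle 𝓘(ℝ, E) M)))

include hv

/-- A smooth vector field on a compact manifold is complete. -/
theorem exists_global_flow [CompactSpace M] : ∃ F : ℝ → M → M,
    ∀ x, F 0 x = x ∧ IsMIntegralCurve (I := 𝓘(ℝ, E)) (fun t ↦ F t x) v := by
  have : IsManifold 𝓘(ℝ, E) 1 M := IsManifold.of_le (n := ∞) (by simp)
  have hunif : ∃ ε > 0, ∀ x ∈ (Set.univ : Set M), ∃ γ : ℝ → M, γ 0 = x ∧
      IsMIntegralCurveOn (I := 𝓘(ℝ, E)) γ v (Set.Ioo (-ε) ε) := by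
    refine isCompact_univ.induction_on (p := fun s ↦ ∃ ε > 0, ∀ x ∈ s, ∃ γ : ℝ → M, γ 0 = x ∧
      IsMIntegralCurveOn (I := 𝓘(ℝ, E)) γ v (Set.Ioo (-ε) ε)) ⟨1, one_pos, by simp⟩ ?_ ?_ ?_
    · rintro s t hst ⟨ε, hε, h⟩
      exact ⟨ε, hε, fun x hx ↦ h x (hst hx)⟩
    · rintro s t ⟨ε, hε, h⟩ ⟨δ, hδ, h'⟩
      refine ⟨min ε δ, lt_min hε hδ, fun x hx ↦ ?_⟩
      rcases hx with hx | hx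
      · obtain ⟨γ, h0, hγ⟩ := h x hx
        exact ⟨γ, h0, hγ.mono (Set.Ioo_subset_Ioo (neg_le_neg (min_le_left _ _))
          (min_le_left _ _))⟩
      · obtain ⟨γ, h0, hγ⟩ := h' x hx
        exact ⟨γ, h0, hγ.mono (Set.Ioo_subset_Ioo (neg_le_neg (min_le_right _ _))
          (min_le_right _ _))⟩
    · intro x₀ _
      obtain ⟨c, -, hc⟩ := exists_smooth_family_isMIntegralCurveOn hv x₀
      rw [nhds_prod_eq] at hc
      obtain ⟨P, hP, Q, hQ, hPQ⟩ := Filter.eventually_prod_iff.1 hc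
      obtain ⟨δ, hδ, hball⟩ := Metric.eventually_nhds_iff.1 hP
      refine ⟨{x | Q x}, mem_nhdsWithin_of_mem_nhds hQ, δ / 2, by positivity, fun x hx ↦ ?_⟩
      have hPδ : P (δ / 2) := hball (by
        rw [Real.dist_eq, sub_zero, abs_of_pos (by positivity)]; linarith)
      obtain ⟨h0, hcurve⟩ := hPQ hPδ hx
      -- Undoing the time scale `δ / 2` turns a curve on `(-1, 1)` for the scaled field into one on
      -- `(-δ/2, δ/2)` for `v`.
      refine ⟨c (δ / 2, x) ∘ (· * (δ / 2)⁻¹), by simpa using h0, ?_⟩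
      have h1 := hcurve.comp_mul (δ / 2)⁻¹
      rw [smul_smul, inv_mul_cancel₀ (by positivity), one_smul] at h1
      refine h1.mono fun t ht ↦ ?_
      rw [Set.mem_ofPred_eq, ← div_eq_mul_inv]
      exact ⟨by rw [lt_div_iff₀ (by positivity)]; linarith [ht.1],
        by rw [div_lt_iff₀ (by positivity)]; linarith [ht.2]⟩
  obtain ⟨ε, hε, h⟩ := hunif
  have hglob := exists_isMIntegralCurve_of_isMIntegralCurveOn (hv.of_le (by simp)) hε
    fun x ↦ h x (Set.mem_univ x)
  choose γ hγ0 hγ using hglob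
  exact ⟨fun t x ↦ γ x t, fun x ↦ ⟨hγ0 x, hγ x⟩⟩

variable {F : ℝ → M → M}
  (hF : ∀ x, F 0 x = x ∧ IsMIntegralCurve (I := 𝓘(ℝ, E)) (fun t ↦ F t x) v)

include hF

omit [FiniteDimensional ℝ E] in
theorem flow_unique {F' : ℝ → M → M}
    (hF' : ∀ x, F' 0 x = x ∧ IsMIntegralCurve (I := 𝓘(ℝ, E)) (fun t ↦ F' t x) v) : F = F' := by
  have : IsManifold 𝓘(ℝ, E) 1 M := IsManifold.of_le (n := ∞) (by simp)
  funext t x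
  exact congrFun (isMIntegralCurve_Ioo_eq_of_contMDiff_boundaryless (t₀ := 0)
    (hv.of_le (by simp)) (hF x).2 (hF' x).2 ((hF x).1.trans (hF' x).1.symm)) t

omit [FiniteDimensional ℝ E] in
theorem flow_add (s t : ℝ) (x : M) : F (s + t) x = F s (F t x) := by
  have : IsManifold 𝓘(ℝ, E) 1 M := IsManifold.of_le (n := ∞) (by simp)
  have h := isMIntegralCurve_Ioo_eq_of_contMDiff_boundaryless (t₀ := 0)
    (hv.of_le (by simp)) ((hF x).2.comp_add t) (hF (F t x)).2
    (by simp [(hF (F t x)).1])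
  exact congrFun h s

/-- By uniqueness of integral curves, the flow at time `t` is the local family with time scale `2t`
read at parameter `1/2`. Smoothness in the scale thus becomes smoothness in time. -/
theorem contMDiffAt_flow_zero (x₀ : M) :
    ContMDiffAt (𝓘(ℝ, ℝ).prod 𝓘(ℝ, E)) 𝓘(ℝ, E) ∞ (fun p : ℝ × M ↦ F p.1 p.2) (0, x₀) := by
  have : IsManifold 𝓘(ℝ, E) 1 M := IsManifold.of_le (n := ∞) (by simp)
  obtain ⟨c, hsmooth, hc⟩ := exists_smooth_family_isMIntegralCurveOn hv x₀
  have hmap : ContMDiffAt (𝓘(ℝ, ℝ).prod 𝓘(ℝ, E)) (𝓘(ℝ, ℝ).prod 𝓘(ℝ, E)) ∞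
      (fun p : ℝ × M ↦ (2 * p.1, p.2)) (0, x₀) :=
    (ContMDiffAt.comp (I' := 𝓘(ℝ, ℝ)) _
      (contDiff_const.mul contDiff_id).contMDiff.contMDiffAt contMDiffAt_fst).prodMk contMDiffAt_snd
  have h0 : ((2 * (0 : ℝ), x₀) : ℝ × M) = (0, x₀) := by simp
  have h1 : ContMDiffAt (𝓘(ℝ, ℝ).prod 𝓘(ℝ, E)) 𝓘(ℝ, E) ∞
      (fun p : ℝ × M ↦ c (2 * p.1, p.2) (1 / 2)) (0, x₀) :=
    ContMDiffAt.comp (g := fun q ↦ c q (1 / 2)) (0, x₀) (by rwa [h0]) hmap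
  refine h1.congr_of_eventuallyEq ?_
  have hc' := hmap.continuousAt.eventually (p := fun q ↦ c q 0 = q.2 ∧
        IsMIntegralCurveOn (I := 𝓘(ℝ, E)) (c q) (q.1 • v) (Set.Ioo (-1) 1)) (by dsimp only; rwa [h0])
  filter_upwards [hc'] with p hp
  have h2 := ((hF p.2).2.comp_mul (2 * p.1)).isMIntegralCurveOn (Set.Ioo (-1) 1)
  have h3 := isMIntegralCurveOn_Ioo_eqOn_of_contMDiff_boundaryless (t₀ := 0) (by norm_num)
    ((hv.of_le (by simp)).const_smul_section (a := 2 * p.1)) h2 hp.2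
    (by simp [hp.1, (hF p.2).1])
  have h4 := h3 (show (1 / 2 : ℝ) ∈ Set.Ioo (-1 : ℝ) 1 by norm_num)
  rw [← h4]
  simp

/-- The flow of a smooth vector field on a compact manifold is jointly smooth. -/
theorem contMDiff_flow [CompactSpace M] :
    ContMDiff (𝓘(ℝ, ℝ).prod 𝓘(ℝ, E)) 𝓘(ℝ, E) ∞ (fun p : ℝ × M ↦ F p.1 p.2) := by
  -- The order is made finite because being `C^k` at a point is then an open condition, as the tube
  -- lemma requires.
  rw [contMDiff_infty]
  intro k
  have : IsManifold 𝓘(ℝ, E) k M := IsManifold.of_le (n := ∞) (WithTop.coe_le_coe.2 le_top)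
  let S : Set (ℝ × M) := {p | ContMDiffAt (𝓘(ℝ, ℝ).prod 𝓘(ℝ, E)) 𝓘(ℝ, E) k
    (fun p : ℝ × M ↦ F p.1 p.2) p}
  have hmem : ∀ p, p ∈ S → ContMDiffAt (𝓘(ℝ, ℝ).prod 𝓘(ℝ, E)) 𝓘(ℝ, E) k
    (fun p : ℝ × M ↦ F p.1 p.2) p := fun _ h ↦ h
  have hS : IsOpen S := by
    rw [isOpen_iff_mem_nhds]
    intro p hp
    exact (contMDiffAt_iff_contMDiffAt_nhds (by simp)).1 hp
  have hS0 : ({0} : Set ℝ) ×ˢ (Set.univ : Set M) ⊆ S := by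
    rintro ⟨t, x⟩ ⟨ht, -⟩
    rw [Set.mem_singleton_iff] at ht
    subst ht
    exact contMDiffAt_infty.1 (contMDiffAt_flow_zero hv hF x) k
  obtain ⟨u, w, hu, -, h0u, hw, huw⟩ :=
    generalized_tube_lemma isCompact_singleton isCompact_univ hS hS0
  obtain ⟨ε, hε, hball⟩ := Metric.isOpen_iff.1 hu 0 (h0u rfl)
  have hsmall : ∀ t x, |t| < ε → (t, x) ∈ S := fun t x ht ↦
    huw ⟨hball (by simpa using ht), hw (Set.mem_univ x)⟩
  -- The time is split as `t = t/(m+1) + tm/(m+1)`: the first part is below `ε`, the second below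
  -- `mε`, and the group law writes the flow as a composite.
  have hm : ∀ m : ℕ, ∀ t x, |t| < m * ε → (t, x) ∈ S := by
    intro m
    induction m with
    | zero =>
      intro t x ht
      simp only [Nat.cast_zero, zero_mul] at ht
      exact absurd ht (not_lt.2 (abs_nonneg t))
    | succ m ih =>
      intro t x ht
      have hpos : (0 : ℝ) < m + 1 := by positivity
      push_cast at ht
      rcases Nat.eq_zero_or_pos m with rfl | hmpos
      · exact hsmall t x (by simpa using ht)
      have hmpos' : (0 : ℝ) < m := by exact_mod_cast hmpos
      have h1 : |t * (1 / (m + 1))| < ε := by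
        rw [abs_mul, abs_of_pos (by positivity : (0 : ℝ) < 1 / (m + 1)), mul_one_div,
          div_lt_iff₀ hpos]
        linarith
      have h2 : |t * (m / (m + 1))| < m * ε := by
        rw [abs_mul, abs_of_pos (by positivity : (0 : ℝ) < m / (m + 1)), ← mul_div_assoc,
          div_lt_iff₀ hpos, mul_comm]
        nlinarith
      have hlin : ∀ a : ℝ, ContMDiffAt (𝓘(ℝ, ℝ).prod 𝓘(ℝ, E)) 𝓘(ℝ, ℝ) k
          (fun p : ℝ × M ↦ p.1 * a) (t, x) := fun a ↦
        ContMDiffAt.comp (I' := 𝓘(ℝ, ℝ)) (g := fun s : ℝ ↦ s * a) _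
          (contDiff_id.mul contDiff_const).contMDiff.contMDiffAt contMDiffAt_fst
      have h3 : ContMDiffAt (𝓘(ℝ, ℝ).prod 𝓘(ℝ, E)) 𝓘(ℝ, E) k
          (fun p : ℝ × M ↦ F (p.1 * (m / (m + 1))) p.2) (t, x) :=
        ContMDiffAt.comp (g := fun p : ℝ × M ↦ F p.1 p.2) (t, x)
          (f := fun p : ℝ × M ↦ (p.1 * (m / (m + 1)), p.2)) (hmem _ (ih _ x h2))
          ((hlin _).prodMk contMDiffAt_snd)
      have h4 : ContMDiffAt (𝓘(ℝ, ℝ).prod 𝓘(ℝ, E)) 𝓘(ℝ, E) k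
          (fun p : ℝ × M ↦ F (p.1 * (1 / (m + 1))) (F (p.1 * (m / (m + 1))) p.2)) (t, x) :=
        ContMDiffAt.comp (g := fun p : ℝ × M ↦ F p.1 p.2) (t, x)
          (f := fun p : ℝ × M ↦ (p.1 * (1 / (m + 1)), F (p.1 * (m / (m + 1))) p.2))
          (hmem _ (hsmall _ _ h1))
          ((hlin _).prodMk h3)
      have h5 : (fun p : ℝ × M ↦ F p.1 p.2) =
          fun p ↦ F (p.1 * (1 / (m + 1))) (F (p.1 * (m / (m + 1))) p.2) := by
        funext p
        rw [← flow_add hv hF]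
        congr 1
        field_simp
        ring
      change ContMDiffAt _ _ _ _ _
      rw [h5]
      exact h4
  rintro ⟨t, x⟩
  obtain ⟨m, hmt⟩ := exists_nat_gt (|t| / ε)
  exact hm m t x ((div_lt_iff₀ hε).1 hmt)

end Global

end Flow

/-! ### Invariance of the contact form under its Reeb flow. -/

section Invariance

variable {E : Type*} [NormedAddCommGroup E] [NormedSpace ℝ E] [FiniteDimensional ℝ E]
  {M : Type*} [TopologicalSpace M] [ChartedSpace E M] [IsManifold 𝓘(ℝ, E) ∞ M]
  {α : OneForm E M} {R : ∀ x : M, TangentSpace 𝓘(ℝ, E) x} {F : ℝ → M → M}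

omit [FiniteDimensional ℝ E] [IsManifold 𝓘(ℝ, E) ∞ M] in
theorem contMDiff_flow_time
    (hsm : ContMDiff (𝓘(ℝ, ℝ).prod 𝓘(ℝ, E)) 𝓘(ℝ, E) ∞ (fun p : ℝ × M ↦ F p.1 p.2)) (t : ℝ) :
    ContMDiff 𝓘(ℝ, E) 𝓘(ℝ, E) ∞ (F t) :=
  hsm.comp (contMDiff_const.prodMk contMDiff_id)

/-- The Lie derivative of a one-form along its Reeb field vanishes. -/
theorem hasDerivAt_pullback_zero (hα : α.IsSmooth) (hR : IsReebField α R)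
    (hsm : ContMDiff (𝓘(ℝ, ℝ).prod 𝓘(ℝ, E)) 𝓘(ℝ, E) ∞ (fun p : ℝ × M ↦ F p.1 p.2))
    (hF : ∀ x, F 0 x = x ∧ IsMIntegralCurve (I := 𝓘(ℝ, E)) (fun t ↦ F t x) R)
    (z : M) (w : TangentSpace 𝓘(ℝ, E) z) :
    HasDerivAt (fun s ↦ α (F s z) (mfderiv 𝓘(ℝ, E) 𝓘(ℝ, E) (F s) z w)) 0 0 := by
  set e := extChartAt 𝓘(ℝ, E) z with he
  have hz : z ∈ e.source := mem_extChartAt_source z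
  have hy₀ : e z ∈ e.target := e.map_source hz
  have hback : e.symm (e z) = z := e.left_inv hz
  have hF0 : F 0 = id := funext fun x ↦ (hF x).1
  set a := α.inChart z with ha
  let ψ : ℝ × E → E := fun p ↦ e (F p.1 (e.symm p.2))
  let w' : E := chartD z z w
  -- points near `(0, e z)`
  have hinner : ContMDiffOn 𝓘(ℝ, ℝ × E) 𝓘(ℝ, E) ∞ (fun p : ℝ × E ↦ F p.1 (e.symm p.2))
      {p | p.2 ∈ e.target} := by
    have h1 : ContMDiff 𝓘(ℝ, ℝ × E) 𝓘(ℝ, ℝ) ∞ (Prod.fst : ℝ × E → ℝ) := contDiff_fst.contMDiff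
    have h2 : ContMDiff 𝓘(ℝ, ℝ × E) 𝓘(ℝ, E) ∞ (Prod.snd : ℝ × E → E) := contDiff_snd.contMDiff
    exact hsm.comp_contMDiffOn (h1.contMDiffOn.prodMk
      ((contMDiffOn_extChartAt_symm z).comp h2.contMDiffOn fun p hp ↦ hp))
  have hopen : IsOpen {p : ℝ × E | p.2 ∈ e.target} :=
    (isOpen_extChartAt_target z).preimage continuous_snd
  have hgood : ∀ᶠ p in 𝓝 ((0 : ℝ), e z), p.2 ∈ e.target ∧ F p.1 (e.symm p.2) ∈ e.source := by
    refine Filter.Eventually.and (hopen.mem_nhds hy₀) ?_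
    refine (hinner.continuousOn.continuousAt (hopen.mem_nhds hy₀)).eventually ?_
    dsimp only
    rw [hback, hF0]
    exact (isOpen_extChartAt_source z).mem_nhds hz
  have hψ : ∀ p : ℝ × E, p.2 ∈ e.target ∧ F p.1 (e.symm p.2) ∈ e.source → ContDiffAt ℝ ∞ ψ p := by
    rintro p ⟨h1, h2⟩
    rw [← contMDiffAt_iff_contDiffAt]
    exact ContMDiffAt.comp (I' := 𝓘(ℝ, E)) p
      (contMDiffAt_extChartAt' (by rwa [he, extChartAt_source] at h2))
      (hinner.contMDiffAt (hopen.mem_nhds h1))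
  -- Cartan's formula in disguise: `b` is the pullback of `α` to time times space. Its component
  -- `b(∂_t) = α(R) = 1` is constant, so `db(∂_t, w')` is the time derivative of `b(w')`; by
  -- naturality it is also `dα(R, w) = 0`.
  let b : ℝ × E → ℝ × E →L[ℝ] ℝ := fun p ↦ (a (ψ p)).comp (fderiv ℝ ψ p)
  -- the derivative in the time direction
  have htime : ∀ p : ℝ × E, p.2 ∈ e.target ∧ F p.1 (e.symm p.2) ∈ e.source →
      fderiv ℝ ψ p (1, 0) = (fun x ↦ chartD z x (R x)) (F p.1 (e.symm p.2)) := by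
    rintro ⟨s, y⟩ hp
    have h1 : HasFDerivAt ψ (fderiv ℝ ψ (s, y)) (s, y) :=
      ((hψ _ hp).differentiableAt (by simp)).hasFDerivAt
    have h2 := HasFDerivAt.comp (g := ψ) s h1 (hasFDerivAt_prodMk_left (𝕜 := ℝ) s y)
    have h3 := HasMFDerivAt.comp (I' := 𝓘(ℝ, E)) s
      (mdifferentiableAt_chart hp.2).hasMFDerivAt ((hF (e.symm y)).2 s)
    have h4 := h2.unique h3.hasFDerivAt
    have h5 := DFunLike.congr_fun h4 (1 : ℝ)
    refine Eq.trans ?_ (h5.trans ?_)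
    · simp
    · change chartD z _ ((1 : ℝ) • R _) = _
      rw [one_smul]
  have hspace : ∀ s : ℝ, F s z ∈ e.source → fderiv ℝ ψ (s, e z) (0, w') =
      chartD z (F s z) (mfderiv 𝓘(ℝ, E) 𝓘(ℝ, E) (F s) z w) := by
    intro s hs
    have hp : (s, e z).2 ∈ e.target ∧ F (s, e z).1 (e.symm (s, e z).2) ∈ e.source :=
      ⟨hy₀, by dsimp only; rwa [hback]⟩
    have h1 : HasFDerivAt ψ (fderiv ℝ ψ (s, e z)) (s, e z) :=
      ((hψ _ hp).differentiableAt (by simp)).hasFDerivAt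
    have h2 := (h1.comp (e z) (hasFDerivAt_prodMk_right s (e z))).hasMFDerivAt
    have h3 := HasMFDerivAt.comp (I' := 𝓘(ℝ, E)) z h2 (mdifferentiableAt_chart hz).hasMFDerivAt
    have h4 := HasMFDerivAt.comp (I' := 𝓘(ℝ, E)) z (mdifferentiableAt_chart hs).hasMFDerivAt
      ((contMDiff_flow_time hsm s z).mdifferentiableAt (by simp)).hasMFDerivAt
    have h5 : (ψ ∘ Prod.mk s) ∘ e =ᶠ[𝓝 z] e ∘ F s := by
      filter_upwards [(isOpen_extChartAt_source (I := 𝓘(ℝ, E)) z).mem_nhds hz] with x hx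
      simp only [Function.comp_apply, ψ]
      rw [e.left_inv hx]
    have h6 := DFunLike.congr_fun (hasMFDerivAt_unique h3 (h4.congr_of_eventuallyEq h5)) w
    refine Eq.trans ?_ h6
    change _ = fderiv ℝ ψ (s, e z) (ContinuousLinearMap.inr ℝ ℝ E w')
    simp
  have hp₀ : ((0 : ℝ), e z).2 ∈ e.target ∧ F ((0 : ℝ), e z).1 (e.symm ((0 : ℝ), e z).2) ∈ e.source :=
    hgood.self_of_nhds
  have hψ₀ : ψ (0, e z) = e z := by simp only [ψ, hback, hF0, id]
  have hda : DifferentiableAt ℝ a (ψ (0, e z)) := by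
    rw [hψ₀]; exact differentiableAt_inChart hα z hy₀
  have hb : DifferentiableAt ℝ b (0, e z) := by
    refine DifferentiableAt.clm_comp (hda.comp _ ((hψ _ hp₀).differentiableAt (by simp))) ?_
    exact ((hψ _ hp₀).fderiv_right (m := ∞) le_rfl).differentiableAt (by simp)
  have hpull := formD_pullback hda (hψ _ hp₀) (1, 0) (0, w')
  have hright : formD a (ψ (0, e z)) (fderiv ℝ ψ (0, e z) (1, 0)) (fderiv ℝ ψ (0, e z) (0, w')) =
      0 := by
    have h1 : fderiv ℝ ψ (0, e z) (1, 0) = chartD z z (R z) := by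
      rw [htime _ hp₀]
      dsimp only
      rw [hback, hF0, id]
    have h2 : fderiv ℝ ψ (0, e z) (0, w') = chartD z z w := by
      rw [hspace 0 (by rw [hF0]; exact hz), hF0, mfderiv_id]
      rfl
    rw [hψ₀, h1, h2, ← d_eq_formD hα hz]
    exact (hR z).2 w
  have hleft : formD b (0, e z) (1, 0) (0, w') = fderiv ℝ b (0, e z) (1, 0) (0, w') := by
    rw [formD_eq hb]
    have h1 : (fun p ↦ b p (1, 0)) =ᶠ[𝓝 (0, e z)] fun _ ↦ (1 : ℝ) := by
      filter_upwards [hgood] with p hp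
      simp only [b, ContinuousLinearMap.comp_apply]
      rw [htime p hp]
      exact (inChart_mfderiv α hp.2 _).trans (hR _).1
    have h2 : HasFDerivAt (fun p ↦ b p (1, 0)) (0 : ℝ × E →L[ℝ] ℝ) (0, e z) :=
      (hasFDerivAt_const _ _).congr_of_eventuallyEq h1
    have h3 := (hb.hasFDerivAt.clm_apply (hasFDerivAt_const ((1 : ℝ), (0 : E)) _)).unique h2
    have h4 := DFunLike.congr_fun h3 ((0 : ℝ), w')
    simp only [ContinuousLinearMap.comp_zero, zero_add, ContinuousLinearMap.flip_apply,
      zero_apply] at h4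
    rw [h4, sub_zero]
  have hzero : fderiv ℝ b (0, e z) (1, 0) (0, w') = 0 :=
    hleft.symm.trans (hpull.trans hright)
  have hder : HasDerivAt (fun s : ℝ ↦ b (s, e z) (0, w')) 0 0 := by
    have h1 := (hb.hasFDerivAt.comp (0 : ℝ) (hasFDerivAt_prodMk_left 0 (e z))).hasDerivAt
    have h2 := h1.clm_apply (hasDerivAt_const (0 : ℝ) ((0 : ℝ), w'))
    convert! h2 using 1
    simpa using hzero.symm
  refine hder.congr_of_eventuallyEq ?_
  have hsrc : ∀ᶠ s in 𝓝 (0 : ℝ), F s z ∈ e.source := by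
    have : ContinuousAt (fun s ↦ F s z) 0 := ((hF z).2.continuous).continuousAt
    refine this.eventually ?_
    dsimp only
    rw [hF0]
    exact (isOpen_extChartAt_source z).mem_nhds hz
  filter_upwards [hsrc] with s hs
  simp only [b, ContinuousLinearMap.comp_apply, hspace s hs, ψ]
  rw [hback]
  exact (inChart_mfderiv α hs _).symm

/-- The Reeb flow preserves the contact form. -/
theorem reebFlow_pullback [T2Space M] (hα : α.IsSmooth) (hR : IsReebField α R)
    (hRs : ContMDiff 𝓘(ℝ, E) (𝓘(ℝ, E).prod 𝓘(ℝ, E)) ∞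
      (fun x ↦ (⟨x, R x⟩ : TangentBundle 𝓘(ℝ, E) M)))
    (hsm : ContMDiff (𝓘(ℝ, ℝ).prod 𝓘(ℝ, E)) 𝓘(ℝ, E) ∞ (fun p : ℝ × M ↦ F p.1 p.2))
    (hF : ∀ x, F 0 x = x ∧ IsMIntegralCurve (I := 𝓘(ℝ, E)) (fun t ↦ F t x) R)
    (t : ℝ) (x : M) (v : TangentSpace 𝓘(ℝ, E) x) :
    α (F t x) (mfderiv 𝓘(ℝ, E) 𝓘(ℝ, E) (F t) x v) = α x v := by
  let h : ℝ → ℝ := fun t ↦ α (F t x) (mfderiv 𝓘(ℝ, E) 𝓘(ℝ, E) (F t) x v)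
  have hmd : ∀ t y, MDifferentiableAt 𝓘(ℝ, E) 𝓘(ℝ, E) (F t) y := fun t y ↦
    (contMDiff_flow_time hsm t y).mdifferentiableAt (by simp)
  have hh : ∀ t, HasDerivAt h 0 t := by
    intro t
    have h1 := hasDerivAt_pullback_zero hα hR hsm hF (F t x)
      (mfderiv 𝓘(ℝ, E) 𝓘(ℝ, E) (F t) x v)
    have h2 : (fun s ↦ h (s + t)) = fun s ↦ α (F s (F t x)) (mfderiv 𝓘(ℝ, E) 𝓘(ℝ, E) (F s) (F t x)
        (mfderiv 𝓘(ℝ, E) 𝓘(ℝ, E) (F t) x v)) := by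
      funext s
      have h3 : F (s + t) = F s ∘ F t := funext fun y ↦ flow_add hRs hF s t y
      simp only [h]
      rw [h3, mfderiv_comp x (hmd s _) (hmd t _)]
      rfl
    rw [← h2] at h1
    have h4 := HasDerivAt.comp_sub_const (f := fun s ↦ h (s + t)) t t (by rwa [sub_self])
    simpa using h4
  have hconst : h t = h 0 := is_const_of_deriv_eq_zero (fun t ↦ (hh t).differentiableAt)
    (fun t ↦ (hh t).deriv) t 0
  have hF0 : F 0 = id := funext fun x ↦ (hF x).1
  have h0 : h 0 = α x v := by
    simp only [h]
    rw [hF0, mfderiv_id]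
    rfl
  exact hconst.trans h0

end Invariance

/-! ### The Reeb flow as a family of contactomorphisms. -/

section ReebDiffeo

variable {E : Type*} [NormedAddCommGroup E] [NormedSpace ℝ E]
  {M : Type*} [TopologicalSpace M] [ChartedSpace E M] [IsManifold 𝓘(ℝ, E) ∞ M]
  {ξ : Distribution E M} {α : OneForm E M} {R : ∀ x : M, TangentSpace 𝓘(ℝ, E) x} {F : ℝ → M → M}

/-- `F` is the flow of the Reeb field `R` of the smooth form `α`, with all objects smooth. -/
structure IsSmoothReebFlow (α : OneForm E M) (R : ∀ x : M, TangentSpace 𝓘(ℝ, E) x)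
    (F : ℝ → M → M) : Prop where
  form_smooth : α.IsSmooth
  isReebField : IsReebField α R
  field_smooth : ContMDiff 𝓘(ℝ, E) (𝓘(ℝ, E).prod 𝓘(ℝ, E)) ∞
    (fun x ↦ (⟨x, R x⟩ : TangentBundle 𝓘(ℝ, E) M))
  flow : ∀ x, F 0 x = x ∧ IsMIntegralCurve (I := 𝓘(ℝ, E)) (fun t ↦ F t x) R
  flow_smooth : ContMDiff (𝓘(ℝ, ℝ).prod 𝓘(ℝ, E)) 𝓘(ℝ, E) ∞ (fun p : ℝ × M ↦ F p.1 p.2)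

variable [FiniteDimensional ℝ E] [T2Space M]

/-- The time-`t` map of the Reeb flow, as a diffeomorphism. -/
def IsSmoothReebFlow.diffeo (h : IsSmoothReebFlow α R F) (t : ℝ) : Diffeo E M where
  toFun := F t
  invFun := F (-t)
  left_inv x := by rw [← flow_add h.field_smooth h.flow, neg_add_cancel, (h.flow x).1]
  right_inv x := by rw [← flow_add h.field_smooth h.flow, add_neg_cancel, (h.flow x).1]
  contMDiff_toFun := contMDiff_flow_time h.flow_smooth t
  contMDiff_invFun := contMDiff_flow_time h.flow_smooth (-t)

namespace IsSmoothReebFlow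

variable (h : IsSmoothReebFlow α R F)

omit [FiniteDimensional ℝ E] in
theorem diffeo_zero : h.diffeo 0 = Diffeomorph.refl 𝓘(ℝ, E) M ∞ :=
  Diffeomorph.ext fun x ↦ (h.flow x).1

omit [FiniteDimensional ℝ E] in
theorem diffeo_trans (s t : ℝ) : (h.diffeo s).trans (h.diffeo t) = h.diffeo (s + t) :=
  Diffeomorph.ext fun x ↦ by
    rw [add_comm]; exact (flow_add h.field_smooth h.flow t s x).symm

include h in
theorem pullback (t : ℝ) (x : M) (v : TangentSpace 𝓘(ℝ, E) x) :
    α (F t x) (mfderiv 𝓘(ℝ, E) 𝓘(ℝ, E) (F t) x v) = α x v :=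
  reebFlow_pullback h.form_smooth h.isReebField h.field_smooth h.flow_smooth h.flow t x v

theorem isContactomorphism_diffeo
    (hker : ∀ x, LinearMap.ker (α x : TangentSpace 𝓘(ℝ, E) x →ₗ[ℝ] ℝ) = ξ x) (t : ℝ) :
    IsContactomorphism ξ (h.diffeo t) := by
  intro x
  rw [← hker, ← hker]
  ext w
  constructor
  · rintro ⟨v, hv, rfl⟩
    exact (h.pullback t x v).trans hv
  · intro hw
    let e := (h.diffeo t).mfderivToContinuousLinearEquiv (by simp) x
    refine ⟨e.symm w, ?_, e.apply_symm_apply w⟩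
    refine (h.pullback t x (e.symm w)).symm.trans ?_
    exact (congrArg (α (F t x)) (e.apply_symm_apply w)).trans hw

end IsSmoothReebFlow

end ReebDiffeo

/-! ### Contact isotopies and their speeds along trajectories. -/

section Isotopy

variable {E : Type*} [NormedAddCommGroup E] [NormedSpace ℝ E]
  {M : Type*} [TopologicalSpace M] [ChartedSpace E M]
  {ξ : Distribution E M} {α : OneForm E M} {φ ψ : Diffeo E M} {Φ : ℝ → Diffeo E M}

theorem IsContactomorphism.trans {φ ψ : Diffeo E M} (hφ : IsContactomorphism ξ φ)
    (hψ : IsContactomorphism ξ ψ) : IsContactomorphism ξ (φ.trans ψ) := by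
  intro x
  have h : mfderiv 𝓘(ℝ, E) 𝓘(ℝ, E) (φ.trans ψ) x =
      (mfderiv 𝓘(ℝ, E) 𝓘(ℝ, E) ψ (φ x)).comp (mfderiv 𝓘(ℝ, E) 𝓘(ℝ, E) φ x) :=
    mfderiv_comp x (ψ.mdifferentiable (by simp) _) (φ.mdifferentiable (by simp) _)
  have h1 := hψ (φ x)
  rw [← hφ x, ← Submodule.map_comp] at h1
  rw [h]
  exact h1

/-- The value of `α` on the velocity of the trajectory of `x` under an isotopy. -/
noncomputable def trajectorySpeed (α : OneForm E M) (Φ : ℝ → Diffeo E M) (t : ℝ) (x : M) : ℝ :=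
  α (Φ t x) (velocity Φ t x)

theorem hamiltonian_eq (t : ℝ) (y : M) :
    hamiltonian α Φ t y = trajectorySpeed α Φ t ((Φ t).symm y) := rfl

/-- The two functions differ by the bijection `Φ t`, so lengths can be computed along trajectories,
without inverses. -/
theorem iSup_abs_hamiltonian (t : ℝ) :
    ⨆ y, |hamiltonian α Φ t y| = ⨆ x, |trajectorySpeed α Φ t x| :=
  (Φ t).symm.toEquiv.iSup_comp (g := fun x ↦ |trajectorySpeed α Φ t x|)

theorem IsContactIsotopy.contMDiffOn_trajectory (h : IsContactIsotopy ξ φ ψ Φ) (x : M) :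
    ContMDiffOn 𝓘(ℝ, ℝ) 𝓘(ℝ, E) ∞ (fun s ↦ Φ s x) (Set.Icc 0 1) :=
  h.smooth.comp (contMDiff_id.prodMk contMDiff_const).contMDiffOn fun _ hs ↦ ⟨hs, Set.mem_univ _⟩

theorem IsContactIsotopy.hasMFDerivWithinAt (h : IsContactIsotopy ξ φ ψ Φ) (x : M) {t : ℝ}
    (ht : t ∈ Set.Icc (0 : ℝ) 1) :
    HasMFDerivWithinAt 𝓘(ℝ, ℝ) 𝓘(ℝ, E) (fun s ↦ Φ s x) (Set.Icc 0 1) t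
      (mfderivWithin 𝓘(ℝ, ℝ) 𝓘(ℝ, E) (fun s ↦ Φ s x) (Set.Icc 0 1) t) :=
  ((h.contMDiffOn_trajectory x t ht).mdifferentiableWithinAt (by simp)).hasMFDerivWithinAt

theorem velocity_eq {t : ℝ} (ht : t ∈ Set.Icc (0 : ℝ) 1) {x : M}
    {f' : TangentSpace 𝓘(ℝ, ℝ) t →L[ℝ] TangentSpace 𝓘(ℝ, E) (Φ t x)}
    (h : HasMFDerivWithinAt 𝓘(ℝ, ℝ) 𝓘(ℝ, E) (fun s ↦ Φ s x) (Set.Icc 0 1) t f') :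
    velocity Φ t x = f' (1 : ℝ) := by
  unfold velocity
  rw [h.mfderivWithin ((uniqueDiffOn_Icc zero_lt_one t ht).uniqueMDiffWithinAt)]

theorem isContactIsotopy_refl : IsContactIsotopy ξ (Diffeomorph.refl 𝓘(ℝ, E) M ∞)
    (Diffeomorph.refl 𝓘(ℝ, E) M ∞) fun _ ↦ Diffeomorph.refl 𝓘(ℝ, E) M ∞ where
  smooth := contMDiff_snd.contMDiffOn
  contact t _ x := by
    have : mfderiv 𝓘(ℝ, E) 𝓘(ℝ, E) (Diffeomorph.refl 𝓘(ℝ, E) M ∞) x =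
      ContinuousLinearMap.id ℝ (TangentSpace 𝓘(ℝ, E) x) := mfderiv_id
    rw [this]
    exact Submodule.map_id _
  start := rfl
  finish := rfl

theorem trajectorySpeed_const (t : ℝ) (ht : t ∈ Set.Icc (0 : ℝ) 1) (x : M) :
    trajectorySpeed α (fun _ ↦ φ) t x = 0 := by
  unfold trajectorySpeed
  rw [velocity_eq ht (hasMFDerivWithinAt_const (φ x) _ _)]
  exact map_zero _

/-- The isotopy run backwards. -/
theorem IsContactIsotopy.reverse (h : IsContactIsotopy ξ φ ψ Φ) :
    IsContactIsotopy ξ ψ φ fun t ↦ Φ (1 - t) where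
  smooth := by
    have h1 : ContMDiff (𝓘(ℝ, ℝ).prod 𝓘(ℝ, E)) 𝓘(ℝ, ℝ) ∞ (fun p : ℝ × M ↦ 1 - p.1) :=
      ContMDiff.comp (I' := 𝓘(ℝ, ℝ)) (g := fun s : ℝ ↦ 1 - s)
        (contDiff_const.sub contDiff_id).contMDiff contMDiff_fst
    exact h.smooth.comp (h1.prodMk contMDiff_snd).contMDiffOn fun p hp ↦
      ⟨⟨by linarith [hp.1.2], by linarith [hp.1.1]⟩, Set.mem_univ _⟩
  contact t ht := h.contact _ ⟨by linarith [ht.2], by linarith [ht.1]⟩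
  start := by rw [sub_zero, h.finish]
  finish := by rw [sub_self, h.start]

theorem IsContactIsotopy.trajectorySpeed_reverse (h : IsContactIsotopy ξ φ ψ Φ) {t : ℝ}
    (ht : t ∈ Set.Icc (0 : ℝ) 1) (x : M) :
    trajectorySpeed α (fun t ↦ Φ (1 - t)) t x = -trajectorySpeed α Φ (1 - t) x := by
  have ht' : 1 - t ∈ Set.Icc (0 : ℝ) 1 := ⟨by linarith [ht.2], by linarith [ht.1]⟩
  have h1 : HasMFDerivWithinAt 𝓘(ℝ, ℝ) 𝓘(ℝ, ℝ) (fun s : ℝ ↦ 1 - s) (Set.Icc 0 1) t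
      (-ContinuousLinearMap.id ℝ ℝ) :=
    ((hasFDerivAt_id t).const_sub 1).hasMFDerivAt.hasMFDerivWithinAt
  have h2 := HasMFDerivWithinAt.comp (I' := 𝓘(ℝ, ℝ)) t (h.hasMFDerivWithinAt x ht') h1
    (fun s hs ↦ ⟨by linarith [hs.2], by linarith [hs.1]⟩)
  unfold trajectorySpeed
  rw [velocity_eq (Φ := fun t ↦ Φ (1 - t)) ht h2]
  rw [← map_neg]
  congr 1
  exact map_neg (mfderivWithin 𝓘(ℝ, ℝ) 𝓘(ℝ, E) (fun s ↦ Φ s x) (Set.Icc 0 1) (1 - t)) (1 : ℝ)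

end Isotopy

/-! ### Composing isotopies with the Reeb flow. -/

section ReebIsotopy

variable {E : Type*} [NormedAddCommGroup E] [NormedSpace ℝ E] [FiniteDimensional ℝ E]
  {M : Type*} [TopologicalSpace M] [ChartedSpace E M] [IsManifold 𝓘(ℝ, E) ∞ M] [T2Space M]
  {ξ : Distribution E M} {α : OneForm E M} {R : ∀ x : M, TangentSpace 𝓘(ℝ, E) x} {F : ℝ → M → M}
  {φ ψ : Diffeo E M} {Ψ : ℝ → Diffeo E M} (h : IsSmoothReebFlow α R F)

/-- Following an isotopy by a reparametrized Reeb flow gives an isotopy. -/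
theorem IsSmoothReebFlow.isContactIsotopy_trans
    (hker : ∀ x, LinearMap.ker (α x : TangentSpace 𝓘(ℝ, E) x →ₗ[ℝ] ℝ) = ξ x)
    (hΨ : IsContactIsotopy ξ φ ψ Ψ) {f : ℝ → ℝ} (hf : ContDiff ℝ ∞ f) :
    IsContactIsotopy ξ (φ.trans (h.diffeo (f 0))) (ψ.trans (h.diffeo (f 1)))
      fun t ↦ (Ψ t).trans (h.diffeo (f t)) where
  smooth := by
    have h1 : ContMDiff (𝓘(ℝ, ℝ).prod 𝓘(ℝ, E)) 𝓘(ℝ, ℝ) ∞ (fun p : ℝ × M ↦ f p.1) :=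
      ContMDiff.comp (I' := 𝓘(ℝ, ℝ)) (g := f) hf.contMDiff contMDiff_fst
    exact h.flow_smooth.comp_contMDiffOn (h1.contMDiffOn.prodMk hΨ.smooth)
  contact t ht := (hΨ.contact t ht).trans (h.isContactomorphism_diffeo hker (f t))
  start := by rw [hΨ.start]
  finish := by rw [hΨ.finish]

/-- The velocity is `f'(t) R` plus the image under the Reeb flow of the velocity of `Ψ`. Speeds add
because `α(R) = 1` and the flow preserves `α`. -/
theorem IsSmoothReebFlow.trajectorySpeed_trans
    (hΨ : IsContactIsotopy ξ φ ψ Ψ) {f : ℝ → ℝ} (hf : ContDiff ℝ ∞ f) {t : ℝ}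
    (ht : t ∈ Set.Icc (0 : ℝ) 1) (x : M) :
    trajectorySpeed α (fun t ↦ (Ψ t).trans (h.diffeo (f t))) t x =
      deriv f t + trajectorySpeed α Ψ t x := by
  have h1 : HasMFDerivWithinAt 𝓘(ℝ, ℝ) 𝓘(ℝ, ℝ) f (Set.Icc 0 1) t (fderiv ℝ f t) :=
    ((hf.differentiable (by simp)) t).hasFDerivAt.hasMFDerivAt.hasMFDerivWithinAt
  have h2 := h1.prodMk (hΨ.hasMFDerivWithinAt x ht)
  have hmd := (h.flow_smooth (f t, Ψ t x)).mdifferentiableAt (by simp)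
  have h3 := HasMFDerivAt.comp_hasMFDerivWithinAt t hmd.hasMFDerivAt h2
  have h4 : velocity (fun t ↦ (Ψ t).trans (h.diffeo (f t))) t x =
      deriv f t • R (F (f t) (Ψ t x)) +
        mfderiv 𝓘(ℝ, E) 𝓘(ℝ, E) (F (f t)) (Ψ t x) (velocity Ψ t x) := by
    rw [velocity_eq (Φ := fun t ↦ (Ψ t).trans (h.diffeo (f t))) ht h3]
    let w : TangentSpace (𝓘(ℝ, ℝ).prod 𝓘(ℝ, E)) (f t, Ψ t x) :=
      ((fderiv ℝ f t 1 : ℝ), (velocity Ψ t x : E))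
    refine (mfderiv_prod_eq_add_apply hmd (v := w)).trans ?_
    rw [← fderiv_apply_one_eq_deriv]
    exact congrArg (· + mfderiv 𝓘(ℝ, E) 𝓘(ℝ, E) (F (f t)) (Ψ t x) (velocity Ψ t x))
      (DFunLike.congr_fun ((h.flow (Ψ t x)).2 (f t)).mfderiv (fderiv ℝ f t 1))
  unfold trajectorySpeed
  rw [h4]
  refine (map_add (α (F (f t) (Ψ t x))) _ _).trans ?_
  congr 1
  · refine (map_smul (α (F (f t) (Ψ t x))) _ _).trans ?_
    rw [(h.isReebField _).1, smul_eq_mul, mul_one]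
  · exact h.pullback _ _ _

theorem IsSmoothReebFlow.isContactIsotopy
    (hker : ∀ x, LinearMap.ker (α x : TangentSpace 𝓘(ℝ, E) x →ₗ[ℝ] ℝ) = ξ x)
    (a b : ℝ) : IsContactIsotopy ξ (h.diffeo a) (h.diffeo b)
      fun t ↦ (Diffeomorph.refl 𝓘(ℝ, E) M ∞).trans (h.diffeo (a + t * (b - a))) := by
  have h1 := h.isContactIsotopy_trans hker isContactIsotopy_refl
    (f := fun t ↦ a + t * (b - a)) (by fun_prop)
  simpa only [zero_mul, add_zero, one_mul, add_sub_cancel, Diffeomorph.refl_trans] using h1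

theorem IsSmoothReebFlow.trajectorySpeed_eq (a b : ℝ) {t : ℝ}
    (ht : t ∈ Set.Icc (0 : ℝ) 1) (x : M) :
    trajectorySpeed α (fun t ↦ (Diffeomorph.refl 𝓘(ℝ, E) M ∞).trans
      (h.diffeo (a + t * (b - a)))) t x = b - a := by
  rw [h.trajectorySpeed_trans (ξ := fun x ↦ LinearMap.ker (α x : TangentSpace 𝓘(ℝ, E) x →ₗ[ℝ] ℝ))
    isContactIsotopy_refl (f := fun t ↦ a + t * (b - a)) (by fun_prop) ht,
    trajectorySpeed_const t ht]
  simp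

/-- The time-`t` map of the Reeb flow, as an element of `Cont₀`. -/
def IsSmoothReebFlow.cont0 (hker : ∀ x, LinearMap.ker (α x : TangentSpace 𝓘(ℝ, E) x →ₗ[ℝ] ℝ) = ξ x)
    (t : ℝ) : Cont0 ξ :=
  ⟨h.diffeo t, _, h.diffeo_zero ▸ h.isContactIsotopy hker 0 t⟩

theorem IsSmoothReebFlow.nonnegRel_of_le
    (hker : ∀ x, LinearMap.ker (α x : TangentSpace 𝓘(ℝ, E) x →ₗ[ℝ] ℝ) = ξ x) {a b : ℝ}
    (hab : a ≤ b) : NonnegRel ξ α (h.cont0 hker a) (h.cont0 hker b) := by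
  refine ⟨_, h.isContactIsotopy hker a b, fun t ht y ↦ ?_⟩
  rw [hamiltonian_eq, h.trajectorySpeed_eq a b ht]
  exact sub_nonneg.2 hab

end ReebIsotopy

/-! ### Continuity of the speed of an isotopy. -/

section Continuity

variable {E : Type*} [NormedAddCommGroup E] [NormedSpace ℝ E]
  {M : Type*} [TopologicalSpace M] [ChartedSpace E M] [IsManifold 𝓘(ℝ, E) ∞ M]
  {ξ : Distribution E M} {α : OneForm E M} {φ ψ : Diffeo E M} {Φ : ℝ → Diffeo E M}

/-- The speed is `α` evaluated on the tangent map of `(t, x) ↦ Φ t x` along the section `∂_t`, a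
composite of continuous maps. -/
theorem IsContactIsotopy.continuousOn_trajectorySpeed (hα : α.IsSmooth)
    (h : IsContactIsotopy ξ φ ψ Φ) :
    ContinuousOn (fun p : ℝ × M ↦ trajectorySpeed α Φ p.1 p.2)
      (Set.Icc (0 : ℝ) 1 ×ˢ (Set.univ : Set M)) := by
  have : IsManifold 𝓘(ℝ, E) 1 M := IsManifold.of_le (n := ∞) (by simp)
  set S := Set.Icc (0 : ℝ) 1 ×ˢ (Set.univ : Set M)
  let G : ℝ × M → M := fun p ↦ Φ p.1 p.2
  have h1 := h.smooth.continuousOn_tangentMapWithin (by simp)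
    ((uniqueDiffOn_Icc zero_lt_one).uniqueMDiffOn.prod uniqueMDiffOn_univ)
  let σ : ℝ × M → TangentBundle (𝓘(ℝ, ℝ).prod 𝓘(ℝ, E)) (ℝ × M) := fun p ↦ ⟨p, ((1 : ℝ), (0 : E))⟩
  have hσ : Continuous σ := by
    have h0 : Continuous fun x : M ↦ (⟨x, 0⟩ : TangentBundle 𝓘(ℝ, E) M) :=
      (Bundle.contMDiff_zeroSection (n := 0) ℝ (TangentSpace 𝓘(ℝ, E) (M := M))
        (IB := 𝓘(ℝ, E))).continuous
    have h1 : Continuous fun t : ℝ ↦ (tangentBundleModelSpaceHomeomorph 𝓘(ℝ, ℝ)).symm (t, (1 : ℝ)) :=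
      (tangentBundleModelSpaceHomeomorph 𝓘(ℝ, ℝ)).symm.continuous.comp (by fun_prop)
    have h2 := (contMDiff_equivTangentBundleProd_symm (I := 𝓘(ℝ, ℝ)) (M := ℝ) (I' := 𝓘(ℝ, E))
      (M' := M) (n := 0)).continuous
    exact h2.comp ((h1.comp continuous_fst).prodMk (h0.comp continuous_snd))
  have h2 : ∀ p ∈ S, trajectorySpeed α Φ p.1 p.2 =
      α.eval (tangentMapWithin (𝓘(ℝ, ℝ).prod 𝓘(ℝ, E)) 𝓘(ℝ, E) G S (σ p)) := by
    rintro ⟨t, x⟩ ⟨ht, -⟩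
    have hmd : MDifferentiableWithinAt (𝓘(ℝ, ℝ).prod 𝓘(ℝ, E)) 𝓘(ℝ, E) G S (t, x) :=
      (h.smooth (t, x) ⟨ht, Set.mem_univ _⟩).mdifferentiableWithinAt (by simp)
    have h3 : HasMFDerivWithinAt 𝓘(ℝ, ℝ) (𝓘(ℝ, ℝ).prod 𝓘(ℝ, E)) (fun s : ℝ ↦ (s, x))
        (Set.Icc 0 1) t ((ContinuousLinearMap.id ℝ ℝ).prod 0) :=
      (hasMFDerivAt_id t).hasMFDerivWithinAt.prodMk
        (hasMFDerivAt_const x t).hasMFDerivWithinAt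
    have h4 := HasMFDerivWithinAt.comp (g := G) (u := S) t hmd.hasMFDerivWithinAt h3
      fun _ hs ↦ ⟨hs, Set.mem_univ _⟩
    unfold trajectorySpeed
    dsimp only
    rw [velocity_eq ht h4]
    rfl
  refine ContinuousOn.congr ?_ h2
  exact hα.contMDiff_eval.continuous.comp_continuousOn
    (h1.comp hσ.continuousOn fun _ hp ↦ hp)

end Continuity

/-! ### Smooth primitives with prescribed increase. -/

/-- A continuous function on `[0,1]` with integral less than `c` lies below the derivative of a
smooth function increasing by `c`. -/
theorem exists_contDiff_le_deriv {m : ℝ → ℝ} (hm : ContinuousOn m (Set.Icc 0 1)) {c : ℝ}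
    (hc : ∫ t in (0 : ℝ)..1, m t < c) :
    ∃ f : ℝ → ℝ, ContDiff ℝ ∞ f ∧ f 0 = 0 ∧ f 1 = c ∧ ∀ t ∈ Set.Icc (0 : ℝ) 1, m t ≤ deriv f t := by
  set L := ∫ t in (0 : ℝ)..1, m t with hL
  -- Weierstrass approximation squeezes `p` strictly between `m` and `m + (c - L)`, so its integral
  -- `P` is at most `c`. The linear term of slope `c - P ≥ 0` then makes the total increase exactly
  -- `c`.
  obtain ⟨p, hp⟩ := exists_polynomial_near_of_continuousOn 0 1 (fun t ↦ m t + (c - L) / 2)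
    (hm.add continuousOn_const) ((c - L) / 2) (by linarith)
  have hmint : IntervalIntegrable m MeasureTheory.volume 0 1 :=
    ContinuousOn.intervalIntegrable (by rwa [Set.uIcc_of_le zero_le_one])
  set P := ∫ t in (0 : ℝ)..1, p.eval t with hP
  have hPc : P ≤ c := by
    have h1 : P ≤ ∫ t in (0 : ℝ)..1, (m t + (c - L)) := by
      refine intervalIntegral.integral_mono_on zero_le_one
        (p.continuous.intervalIntegrable _ _) (hmint.add intervalIntegrable_const) fun t ht ↦ ?_
      have := (abs_lt.1 (hp t ht)).2
      linarith
    rw [intervalIntegral.integral_add hmint intervalIntegrable_const,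
      intervalIntegral.integral_const, smul_eq_mul] at h1
    linarith
  have hder : ∀ t, HasDerivAt (fun t ↦ (∫ s in (0 : ℝ)..t, p.eval s) + t * (c - P))
      (p.eval t + (c - P)) t := by
    intro t
    have h1 := (p.continuous.integral_hasStrictDerivAt 0 t).hasDerivAt.add
      ((hasDerivAt_id t).mul_const (c - P))
    rwa [one_mul] at h1
  refine ⟨fun t ↦ (∫ s in (0 : ℝ)..t, p.eval s) + t * (c - P), ?_, by simp, ?_, fun t ht ↦ ?_⟩
  · rw [contDiff_infty_iff_deriv]
    refine ⟨fun t ↦ (hder t).differentiableAt, ?_⟩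
    rw [funext fun t ↦ (hder t).deriv]
    exact (by simpa using p.contDiff_aeval (𝕜 := ℝ) ∞ : ContDiff ℝ ∞ fun t ↦ p.eval t).add contDiff_const
  · dsimp only
    rw [← hP]
    ring
  · rw [(hder t).deriv]
    have := (abs_lt.1 (hp t ht)).1
    linarith

/-! ### Orderability and the computation of the norm. -/

section Norm

variable {E : Type*} [NormedAddCommGroup E] [NormedSpace ℝ E]
  {M : Type*} [TopologicalSpace M] [ChartedSpace E M] [IsManifold 𝓘(ℝ, E) ∞ M] [CompactSpace M]
  {ξ : Distribution E M} {α : OneForm E M} {φ ψ : Diffeo E M} {Φ : ℝ → Diffeo E M}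

theorem IsContactIsotopy.continuousOn_iSup (hα : α.IsSmooth) (h : IsContactIsotopy ξ φ ψ Φ) :
    ContinuousOn (fun t ↦ ⨆ x, |trajectorySpeed α Φ t x|) (Set.Icc 0 1) := by
  have h1 : Continuous fun q : Set.Icc (0 : ℝ) 1 × M ↦ |trajectorySpeed α Φ q.1 q.2| :=
    ((h.continuousOn_trajectorySpeed hα).comp_continuous
      ((continuous_subtype_val.comp continuous_fst).prodMk continuous_snd)
      fun q ↦ ⟨q.1.2, Set.mem_univ _⟩).abs
  have h2 := isCompact_univ.continuous_sSup
    (f := fun (t : Set.Icc (0 : ℝ) 1) (x : M) ↦ |trajectorySpeed α Φ t x|) h1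
  simp only [Set.image_univ] at h2
  exact continuousOn_iff_continuous_domRestrict.2 h2

theorem IsContactIsotopy.abs_trajectorySpeed_le (hα : α.IsSmooth)
    (h : IsContactIsotopy ξ φ ψ Φ) {t : ℝ} (ht : t ∈ Set.Icc (0 : ℝ) 1) (x : M) :
    |trajectorySpeed α Φ t x| ≤ ⨆ x, |trajectorySpeed α Φ t x| := by
  have h1 : Continuous fun x : M ↦ |trajectorySpeed α Φ t x| :=
    ((h.continuousOn_trajectorySpeed hα).comp_continuous
      (continuous_const.prodMk continuous_id) fun q ↦ ⟨ht, Set.mem_univ _⟩).abs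
  refine le_ciSup (f := fun x ↦ |trajectorySpeed α Φ t x|) ?_ x
  rw [← Set.image_univ]
  exact isCompact_univ.bddAbove_image h1.continuousOn

variable [FiniteDimensional ℝ E] [T2Space M] [Nonempty M]
  {R : ∀ x : M, TangentSpace 𝓘(ℝ, E) x} {F : ℝ → M → M} (h : IsSmoothReebFlow α R F)
  (hker : ∀ x, LinearMap.ker (α x : TangentSpace 𝓘(ℝ, E) x →ₗ[ℝ] ℝ) = ξ x)

include h hker

/-- If `Cont₀` is orderable, a contact isotopy from `φ_a` to `φ_b` has length at least `a - b`. -/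
theorem IsSmoothReebFlow.sub_le_integral (hord : IsOrderable ξ α) {a b : ℝ}
    {Ψ : ℝ → Diffeo E M} (hΨ : IsContactIsotopy ξ (h.diffeo a) (h.diffeo b) Ψ) :
    a - b ≤ ∫ t in (0 : ℝ)..1, ⨆ x, |trajectorySpeed α Ψ t x| := by
  by_contra! hlt
  set L := ∫ t in (0 : ℝ)..1, ⨆ x, |trajectorySpeed α Ψ t x|
  -- A whole interval of times is needed: a single coincidence `F s = F a` would be compatible with
  -- a periodic Reeb flow.
  have heq : ∀ s ∈ Set.Ioo (b + L) a, F s = F a := by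
    intro s hs
    obtain ⟨f, hf, hf0, hf1, hmf⟩ := exists_contDiff_le_deriv (c := s - b)
      (hΨ.continuousOn_iSup h.form_smooth) (by linarith [hs.1])
    have h1 : NonnegRel ξ α (h.cont0 hker a) (h.cont0 hker s) := by
      have h2 := h.isContactIsotopy_trans hker hΨ hf
      rw [hf0, hf1, h.diffeo_trans, h.diffeo_trans, add_zero, add_sub_cancel] at h2
      refine ⟨_, h2, fun t ht y ↦ ?_⟩
      rw [hamiltonian_eq, h.trajectorySpeed_trans hΨ hf ht]
      linarith [hmf t ht, neg_le_of_abs_le (hΨ.abs_trajectorySpeed_le h.form_smooth ht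
        (((Ψ t).trans (h.diffeo (f t))).symm y))]
    have h2 := hord.toAntisymm.antisymm _ _ (h.nonnegRel_of_le hker hs.2.le) h1
    exact congrArg (fun φ : Cont0 ξ ↦ ((φ : Diffeo E M) : M → M)) h2
  obtain ⟨x⟩ := ‹Nonempty M›
  obtain ⟨s, hs⟩ := (Set.nonempty_Ioo (a := b + L) (b := a)).2 (by linarith)
  have h1 : HasMFDerivAt 𝓘(ℝ, ℝ) 𝓘(ℝ, E) (fun t ↦ F t x) s
      (0 : TangentSpace 𝓘(ℝ, ℝ) s →L[ℝ] TangentSpace 𝓘(ℝ, E) (F s x)) := by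
    refine (hasMFDerivAt_const (F s x) s).congr_of_eventuallyEq ?_
    filter_upwards [Ioo_mem_nhds hs.1 hs.2] with r hr
    rw [heq r hr, heq s hs]
  have h2 := DFunLike.congr_fun (hasMFDerivAt_unique ((h.flow x).2 s) h1) (1 : ℝ)
  have h3 : R (F s x) = 0 := (one_smul ℝ (R (F s x))).symm.trans h2
  have h4 := (h.isReebField (F s x)).1
  rw [h3, map_zero] at h4
  exact zero_ne_one h4

/-- The infimum is attained by the linearly parametrized Reeb flow. An isotopy and its reversal have
equal length, so `sub_le_integral` bounds that length below by both `-t` and `t`. -/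
theorem IsSmoothReebFlow.shelukhinNorm_cont0 (hord : IsOrderable ξ α) (t : ℝ) :
    shelukhinNorm ξ α (h.cont0 hker t) = |t| := by
  have hmem : |t| ∈ {L : ℝ | ∃ Φ, IsContactIsotopy ξ (Diffeomorph.refl 𝓘(ℝ, E) M ∞)
      (h.cont0 hker t : Diffeo E M) Φ ∧
      L = ∫ t in (0 : ℝ)..1, ⨆ y : M, |hamiltonian α Φ t y|} := by
    have h1 := h.isContactIsotopy hker 0 t
    rw [h.diffeo_zero] at h1
    refine ⟨_, h1, ?_⟩
    have h2 : Set.EqOn (fun s ↦ ⨆ y : M, |hamiltonian α (fun s ↦ (Diffeomorph.refl 𝓘(ℝ, E) M ∞).trans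
        (h.diffeo (0 + s * (t - 0)))) s y|) (fun _ ↦ |t|) (Set.uIcc 0 1) := by
      intro s hs
      rw [Set.uIcc_of_le zero_le_one] at hs
      dsimp only
      rw [iSup_abs_hamiltonian]
      rw [iSup_congr fun x ↦ congrArg abs (h.trajectorySpeed_eq 0 t hs x), ciSup_const, sub_zero]
    rw [intervalIntegral.integral_congr h2]
    simp
  have hlb : ∀ L ∈ {L : ℝ | ∃ Φ, IsContactIsotopy ξ (Diffeomorph.refl 𝓘(ℝ, E) M ∞)
      (h.cont0 hker t : Diffeo E M) Φ ∧
      L = ∫ t in (0 : ℝ)..1, ⨆ y : M, |hamiltonian α Φ t y|}, |t| ≤ L := by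
    rintro L ⟨Φ, hΦ, rfl⟩
    simp only [iSup_abs_hamiltonian]
    rw [← h.diffeo_zero] at hΦ
    refine abs_le'.2 ⟨?_, by simpa using h.sub_le_integral hker hord hΦ⟩
    have h1 := h.sub_le_integral hker hord hΦ.reverse
    have h2 : Set.EqOn (fun s ↦ ⨆ x, |trajectorySpeed α (fun t ↦ Φ (1 - t)) s x|)
        (fun s ↦ ⨆ x, |trajectorySpeed α Φ (1 - s) x|) (Set.uIcc 0 1) := by
      intro s hs
      rw [Set.uIcc_of_le zero_le_one] at hs
      simp only [hΦ.trajectorySpeed_reverse hs, abs_neg]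
    rw [intervalIntegral.integral_congr h2, intervalIntegral.integral_comp_sub_left
      (fun s ↦ ⨆ x, |trajectorySpeed α Φ s x|) 1] at h1
    simpa using h1
  exact le_antisymm (csInf_le ⟨|t|, hlb⟩ hmem) (le_csInf ⟨_, hmem⟩ hlb)

end Norm

/-- A flow of the Reeb vector field of a contact form on a compact manifold is smooth. -/
theorem IsContactForm.exists_isSmoothReebFlow {E : Type*} [NormedAddCommGroup E] [NormedSpace ℝ E]
    [FiniteDimensional ℝ E] {M : Type*} [TopologicalSpace M] [ChartedSpace E M]
    [IsManifold 𝓘(ℝ, E) ∞ M] [CompactSpace M] [T2Space M] {n : ℕ}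
    (hE : Module.finrank ℝ E = 2 * n + 1) {ξ : Distribution E M} {α : OneForm E M}
    (hα : IsContactForm n ξ α) {F : ℝ → M → M} (hF : IsReebFlow α F) :
    ∃ R, IsSmoothReebFlow α R F := by
  obtain ⟨R, hR, hRF⟩ := hF
  have hs := hα.contMDiff_reebField hE hR
  exact ⟨R, hα.smooth, hR, hs, hRF, contMDiff_flow hs hRF⟩

end ContactGeom

/-! ### The main theorem. -/

theorem mainTheorem4 {E : Type*} [NormedAddCommGroup E] [NormedSpace ℝ E]
    {M : Type*} [TopologicalSpace M] [ChartedSpace E M] [IsManifold 𝓘(ℝ, E) ∞ M]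
    [CompactSpace M] [T2Space M] [Nonempty M]
    (n : ℕ) (hE : Module.finrank ℝ E = 2 * n + 1)
    (ξ : ContactGeom.Distribution E M) (α : ContactGeom.OneForm E M)
    (hα : ContactGeom.IsContactForm n ξ α) (hord : ContactGeom.IsOrderable ξ α) :
    (∃! F : ℝ → M → M, ContactGeom.IsReebFlow α F) ∧
    (∀ F : ℝ → M → M, ContactGeom.IsReebFlow α F → ∀ t : ℝ,
      ∃ φ : ContactGeom.Cont0 ξ, (∀ x, (φ : ContactGeom.Diffeo E M) x = F t x) ∧
        ContactGeom.shelukhinNorm ξ α φ = |t|) ∧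
    (⨆ φ : ContactGeom.Cont0 ξ, ((ContactGeom.shelukhinNorm ξ α φ : ℝ) : EReal)) = (⊤ : EReal) := by
  have : FiniteDimensional ℝ E := FiniteDimensional.of_finrank_pos (by omega)
  obtain ⟨R, hR⟩ := hα.exists_isReebField hE
  have hRs := hα.contMDiff_reebField hE hR
  obtain ⟨F, hF⟩ := ContactGeom.exists_global_flow hRs
  have hnorm : ∀ F : ℝ → M → M, ContactGeom.IsReebFlow α F → ∀ t : ℝ,
      ∃ φ : ContactGeom.Cont0 ξ, (∀ x, (φ : ContactGeom.Diffeo E M) x = F t x) ∧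
        ContactGeom.shelukhinNorm ξ α φ = |t| := by
    intro F hF t
    obtain ⟨R, h⟩ := hα.exists_isSmoothReebFlow hE hF
    exact ⟨h.cont0 hα.ker_eq t, fun x ↦ rfl, h.shelukhinNorm_cont0 hα.ker_eq hord t⟩
  refine ⟨⟨F, ⟨R, hR, hF⟩, ?_⟩, hnorm, ?_⟩
  · rintro F' ⟨R', hR', hF'⟩
    obtain rfl := hα.isReebField_unique hE hR hR'
    exact ContactGeom.flow_unique hRs hF' hF
  · refine EReal.eq_top_iff_forall_lt _ |>.2 fun c ↦ ?_
    obtain ⟨φ, -, hφ⟩ := hnorm F ⟨R, hR, hF⟩ (|c| + 1)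
    refine lt_of_lt_of_le ?_
      (le_iSup (fun φ : ContactGeom.Cont0 ξ ↦ ((ContactGeom.shelukhinNorm ξ α φ : ℝ) : EReal)) φ)
    rw [hφ, EReal.coe_lt_coe_iff]
    linarith [le_abs_self c, le_abs_self (|c| + 1)]
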